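/- \textbf{Setting.} Let $x(t)$, $t\in\mathbb R$, be a real, zero-mean, wide-sense stationary process with finite second moments, $r_{xx}(\tau)=\mathbb E\,x(t+\tau)x(t)$, and with a power spectral density, i.e. an integrable real function $P_{xx}$ with $r_{xx}(\tau)=\frac1{2\pi}\int P_{xx}(\omega)e^{j\omega\tau}\,d\omega$; assume it is band-limited, $P_{xx}(\omega)=0$ for $|\omega|>\pi W$, where $W>0$. Let $L\ge 2$ be even and let $c_1,\dots,c_q\in\{0,\dots,L-1\}$ be distinct ($q\ge1$). Channel $i$ produces the multi-coset samples $y_i(n)=x\big((nL+c_i)/W\big)$, $n\in\mathbb Z$. Let $h_i(m)=\operatorname{sinc}\big(\pi(m-c_i/L)\big)$, $\operatorname{sinc}\alpha=\sin\alpha/\alpha$, $\operatorname{sinc}0=1$ (ideal delay by $c_i/W$ seconds, i.e. by the fraction $c_i/L$ of the channel's sampling period $L/W$), and let $z_i(n)=\sum_{m\in\mathbb Z}h_i(m)y_i(n-m)$, the mean-square limit of the symmetric partial sums. From the $N$ samples $y_i(0),\dots,y_i(N-1)$ of each channel form $z_i^N(n)=\sum_{k=0}^{N-1}h_i(n-k)y_i(k)$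 and $\widehat r^{\,N}_{z_az_b}(0)=\frac1N\sum_{n=0}^{N-1}z_a^N(n)z_b^N(n)$. Let $i$ index the $q(q-1)/2+1$ pairs $(a,b)$ consisting of all pairs with $a<b$ and one diagonal pair $(a_0,a_0)$. Put $u_i=r_{z_az_b}(0)$, $\widehat u_i=\widehat r^{\,N}_{z_az_b}(0)$, $m_l=-L/2+1+l$ and $\Psi_{i,l}=e^{-j\frac{2\pi}{L}(c_a-c_b)m_l}$ for $l=0,\dots,L-1$. Let $p(m)=\int_{-\pi W/L}^{\pi W/L}P_{xx}(\omega-2\pi\tfrac WLm)\frac{d\omega}{2\pi}$, and let $v\in\mathbb R^L$ be the vector of subband powers: $v_l=p(m_l)$ if $m_l\ne L/2$, and $v_l=p(L/2)+p(-L/2)$ if $m_l=L/2$ (the two half-subbands at the ends of $[-\pi W,\pi W]$, which alias onto the same column of $\Psi$). \textbf{Claim.} The sequences $z_i$ exist, and $r_{z_az_b}(k)=\mathbb E\,z_a(k+n)z_b(n)$ does not depend on $n$. Moreover: (1) The $\widehat u_i$ are integrable and $\mathbb E\,\widehat u_i\to r_{z_az_b}(0)=u_i$ as $N\to\infty$,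 for every $i$. (2) If, for the pair $(a,b)$ with index $i$, the samples $(y_a(n))_{n\in\mathbb Z},(y_b(n))_{n\in\mathbb Z}$ are jointly Gaussian and $\sum_{m\in\mathbb Z}r_{z_az_b}(m)^2<\infty$, then $\widehat u_i$ has finite variance for every $N$ and $\operatorname{var}\widehat u_i\to0$ as $N\to\infty$. (3) Suppose that the sampling pattern is such that $\Psi$ has full column rank $L$, and let $\Psi^\dagger=(\Psi^H\Psi)^{-1}\Psi^H$ and $\widehat v_{NC}=\Psi^\dagger\widehat u$ (the least-squares solution of $\widehat u=\Psi\widehat v$). Then $\widehat v_{NC}$ is asymptotically unbiased: $\mathbb E\,\widehat v_{NC}\to\Psi^\dagger u=v$ as $N\to\infty$. If in addition the hypotheses of (2) hold for every index $i$, then the covariance matrix of $\widehat v_{NC}$ (in particular the variance of each entry) tends to $0$, and $\widehat v_{NC}$ is statistically consistent: $\widehat v_{NC}\to v$ in mean square and in probability as $N\to\infty$. (4) The same as (3) holds for the real system obtained by stacking real and imaginary parts (leaving out the zero imaginary part of the diagonal equation), i.e. with $\Psi$, $u$, $\widehat u$ replaced by $\widetilde\Psi=\big[\begin{smallmatrix}\Re\Psi\\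 \Im\Psi\end{smallmatrix}\big]\in\mathbb R^{(q(q-1)+1)\times L}$, $\widetilde u$, $\widetilde{\widehat u}$, when $\widetilde\Psi$ has rank $L$. -/

import Mathlib

open MeasureTheory ProbabilityTheory Filter Topology
open scoped ENNReal Matrix ComplexConjugate

noncomputable section

namespace MultiCoset

/-! ### The input process and its power spectral density -/

/-- A real, zero-mean, wide-sense stationary process with autocorrelation function `r`:
finite second moments, `E x(t) = 0`, and `E x(t₁) x(t₂) = r (t₁ - t₂)`. -/
structure IsZeroMeanWSS {Ω : Type*} [MeasurableSpace Ω] (P : Measure Ω)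
    (x : ℝ → Ω → ℝ) (r : ℝ → ℝ) : Prop where
  memLp : ∀ t, MemLp (x t) 2 P
  mean_zero : ∀ t, ∫ ω, x t ω ∂P = 0
  autocorr : ∀ t₁ t₂, ∫ ω, x t₁ ω * x t₂ ω ∂P = r (t₁ - t₂)

/-- `S` is a power spectral density for the autocorrelation function `r`: an integrable function
(of the angular frequency) with `r τ = (2π)⁻¹ ∫ S(w) exp(i w τ) dw`.  (That `S` is even and
nonnegative almost everywhere follows when `r` is an autocorrelation function.) -/
structure IsPSD (S : ℝ → ℝ) (r : ℝ → ℝ) : Prop where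
  integrable : Integrable S
  inversion : ∀ τ : ℝ,
    (r τ : ℂ) = (1 / (2 * Real.pi) : ℂ) * ∫ w : ℝ, (S w : ℂ) * Complex.exp (Complex.I * w * τ)

/-- The process with spectral density `S` is band-limited to `[-πW, πW]`. -/
def IsBandLimited (S : ℝ → ℝ) (W : ℝ) : Prop :=
  ∀ w : ℝ, Real.pi * W < |w| → S w = 0

/-! ### Multi-coset sampling and fractional delays -/

/-- The multi-coset samples `y_i(n) = x ((n L + c_i) / W)`. -/
def mcSample {Ω : Type*} (x : ℝ → Ω → ℝ) (W : ℝ) (L : ℕ) {q : ℕ} (c : Fin q → ℕ)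
    (i : Fin q) (n : ℤ) (ω : Ω) : ℝ :=
  x (((n : ℝ) * L + c i) / W) ω

/-- Impulse response of the ideal fractional delay filter of channel `i`.  The delay is `c_i / W`
seconds, which is the fraction `c_i / L` of the sampling period `L / W` of the channel. -/
def delayFilter (L : ℕ) {q : ℕ} (c : Fin q → ℕ) (i : Fin q) (m : ℤ) : ℝ :=
  Real.sinc (Real.pi * ((m : ℝ) - (c i : ℝ) / L))

/-- `z = (z_i(n))` is the output of the ideal filters `h_i` applied to `y_i`: the convolution series
`z_i(n) = ∑_m h_i(m) y_i(n - m)`, summed symmetrically, converges in mean square. -/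
def IsFilterOutput {Ω : Type*} [MeasurableSpace Ω] (P : Measure Ω) {q : ℕ}
    (h : Fin q → ℤ → ℝ) (y z : Fin q → ℤ → Ω → ℝ) : Prop :=
  ∀ (i : Fin q) (n : ℤ), MemLp (z i n) 2 P ∧
    Tendsto (fun M : ℕ => eLpNorm
      (fun ω => (∑ m ∈ Finset.Icc (-(M : ℤ)) (M : ℤ), h i m * y i (n - m) ω) - z i n ω) 2 P)
      atTop (𝓝 0)

/-- The cross-correlation function `r_{fg}(k) = E f(k) g(0)` of two jointly stationary sequences. -/
def crossCorr {Ω : Type*} [MeasurableSpace Ω] (P : Measure Ω) (f g : ℤ → Ω → ℝ) (k : ℤ) : ℝ :=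
  ∫ ω, f k ω * g 0 ω ∂P

/-- The random variables `f(n)`, `g(n)`, `n ∈ ℤ`, are jointly Gaussian. -/
def JointlyGaussian {Ω : Type*} [MeasurableSpace Ω] (P : Measure Ω) (f g : ℤ → Ω → ℝ) : Prop :=
  IsGaussianProcess (Sum.elim f g) P

/-! ### Estimates from `N` samples per channel -/

/-- The discrete rectangular window. -/
def window (N : ℕ) (n : ℤ) : ℝ := if 0 ≤ n ∧ n < (N : ℤ) then 1 else 0

/-- The delayed samples `z^N = (y w_N) ⋆ h` of the observed (windowed) sequence; the series has only
finitely many nonzero terms. -/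
def delayedObs {Ω : Type*} (h : ℤ → ℝ) (y : ℤ → Ω → ℝ) (N : ℕ) (n : ℤ) (ω : Ω) : ℝ :=
  ∑' m : ℤ, h m * (y (n - m) ω * window N (n - m))

theorem delayedObs_eq_sum {Ω : Type*} (h : ℤ → ℝ) (y : ℤ → Ω → ℝ) (N : ℕ) (n : ℤ) (ω : Ω) :
    delayedObs h y N n ω = ∑ k ∈ Finset.range N, h (n - k) * y k ω := by
  unfold delayedObs
  rw [← (Equiv.subLeft n).tsum_eq
    (fun m : ℤ => h m * (y (n - m) ω * window N (n - m)))]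
  rw [tsum_eq_sum (s := (Finset.range N).map Nat.castEmbedding)]
  · rw [Finset.sum_map]
    refine Finset.sum_congr rfl fun k hk => ?_
    have hk' : k < N := Finset.mem_range.mp hk
    simp [window, hk']
  · intro b hb
    have hb' : ¬ (0 ≤ b ∧ b < (N : ℤ)) := by
      rintro ⟨h0, h1⟩
      apply hb
      rw [Finset.mem_map]
      exact ⟨b.toNat, Finset.mem_range.mpr (by omega), by simp [h0]⟩
    simp [window, hb']

/-- The sample correlation at lag `0`, i.e. `(1/N) ∑_{n=0}^{N-1} f(n) g(n)`. -/
def sampleCorr {Ω : Type*} (f g : ℤ → Ω → ℝ) (N : ℕ) (ω : Ω) : ℝ :=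
  (1 / (N : ℝ)) * ∑ n ∈ Finset.range N, f n ω * g n ω

/-- Index set of the `q(q-1)/2 + 1` equations: the pairs `(a, b)` with `a < b`, and one more element
`none`, which stands for a single diagonal pair `(a₀, a₀)`. -/
abbrev PairIndex (q : ℕ) : Type := Option {p : Fin q × Fin q // p.1 < p.2}

/-- The pair of channels with index `i`. -/
def pairOf {q : ℕ} (a₀ : Fin q) : PairIndex q → Fin q × Fin q
  | none => (a₀, a₀)
  | some p => p.1

/-- The vector `u`, with entries `r_{z_a z_b}(0)`. -/
def corrVec {Ω : Type*} [MeasurableSpace Ω] (P : Measure Ω) {q : ℕ} (a₀ : Fin q)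
    (z : Fin q → ℤ → Ω → ℝ) (i : PairIndex q) : ℝ :=
  crossCorr P (z (pairOf a₀ i).1) (z (pairOf a₀ i).2) 0

/-- The vector `û` of sample correlations of the delayed observed samples. -/
def corrEst {Ω : Type*} {q : ℕ} (a₀ : Fin q) (h : Fin q → ℤ → ℝ) (y : Fin q → ℤ → Ω → ℝ)
    (N : ℕ) (ω : Ω) (i : PairIndex q) : ℝ :=
  sampleCorr (delayedObs (h (pairOf a₀ i).1) (y (pairOf a₀ i).1) N)
    (delayedObs (h (pairOf a₀ i).2) (y (pairOf a₀ i).2) N) N ω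

/-! ### The linear system -/

/-- The subband index `m_l = -L/2 + 1 + l` (for even `L`). -/
def bandIndex (L : ℕ) (l : Fin L) : ℤ := -((L / 2 : ℕ) : ℤ) + 1 + (l : ℕ)

/-- The matrix `Ψ`, with entries `exp (-i (2π/L) (c_a - c_b) m_l)`. -/
def Psi {q : ℕ} (a₀ : Fin q) (L : ℕ) (c : Fin q → ℕ) : Matrix (PairIndex q) (Fin L) ℂ :=
  Matrix.of fun i l => Complex.exp (-Complex.I * (2 * Real.pi / L) *
    ((c (pairOf a₀ i).1 : ℂ) - (c (pairOf a₀ i).2 : ℂ)) * (bandIndex L l : ℂ))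

/-- Stacking of real and imaginary parts (the imaginary part of the diagonal entry, which vanishes
in all cases at hand, is left out, so that there are `q(q-1) + 1` rows). -/
def stackReIm {q : ℕ} (w : PairIndex q → ℂ) :
    PairIndex q ⊕ {p : Fin q × Fin q // p.1 < p.2} → ℝ :=
  Sum.elim (fun i => (w i).re) (fun p => (w (some p)).im)

/-- The real matrix obtained from `Ψ` by stacking its real and imaginary parts. -/
def PsiReal {q : ℕ} (a₀ : Fin q) (L : ℕ) (c : Fin q → ℕ) :
    Matrix (PairIndex q ⊕ {p : Fin q × Fin q // p.1 < p.2}) (Fin L) ℝ :=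
  Matrix.of fun s l => stackReIm (fun i => Psi a₀ L c i l) s

/-- The power `∫_{-πW/L}^{πW/L} S(w - 2πWm/L) dw/(2π)`. -/
def bandPower (S : ℝ → ℝ) (W : ℝ) (L : ℕ) (m : ℤ) : ℝ :=
  (1 / (2 * Real.pi)) *
    ∫ w in (-(Real.pi * W / L))..(Real.pi * W / L), S (w - 2 * Real.pi * (W / L) * m)

/-- The vector `v` of subband powers.  For `m_l ≠ L/2` the entry is the power in the subband of index
`m_l`.  The subbands with indices `L/2` and `-L/2` straddle the two ends of the band `[-πW, πW]`,
each with one half inside it; they belong to the same column of `Ψ`, and the entry for `m_l = L/2`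
is the total power in these two halves. -/
def powerVec (S : ℝ → ℝ) (W : ℝ) (L : ℕ) (l : Fin L) : ℝ :=
  if bandIndex L l = ((L / 2 : ℕ) : ℤ) then
    bandPower S W L ((L / 2 : ℕ) : ℤ) + bandPower S W L (-((L / 2 : ℕ) : ℤ))
  else bandPower S W L (bandIndex L l)

/-- The least-squares (left pseudo-)inverse `A† = (Aᴴ A)⁻¹ Aᴴ` of a matrix of full column rank. -/
def pinv {𝕜 ι κ : Type*} [RCLike 𝕜] [Fintype ι] [Fintype κ] [DecidableEq κ]
    (A : Matrix ι κ 𝕜) : Matrix κ ι 𝕜 :=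
  (Aᴴ * A)⁻¹ * Aᴴ

/-! ### Asymptotic properties of a sequence of estimators -/

/-- `est N` has finite expectations, and they converge to `v` as `N → ∞`. -/
def AsympUnbiased {Ω κ 𝕜 : Type*} [MeasurableSpace Ω] [RCLike 𝕜] (P : Measure Ω)
    (est : ℕ → Ω → κ → 𝕜) (v : κ → 𝕜) : Prop :=
  ∀ l, (∀ N, Integrable (fun ω => est N ω l) P) ∧
    Tendsto (fun N => ∫ ω, est N ω l ∂P) atTop (𝓝 (v l))

/-- The covariance matrix `E (X - E X)(X - E X)ᴴ` of a random vector. -/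
def covMat {Ω κ 𝕜 : Type*} [MeasurableSpace Ω] [RCLike 𝕜] (P : Measure Ω)
    (X : Ω → κ → 𝕜) : Matrix κ κ 𝕜 :=
  Matrix.of fun k l =>
    ∫ ω, (X ω k - ∫ ω', X ω' k ∂P) * conj (X ω l - ∫ ω', X ω' l ∂P) ∂P

/-- `est N` has finite second moments, and its covariance matrix tends to zero as `N → ∞`. -/
def VarianceVanishes {Ω κ 𝕜 : Type*} [MeasurableSpace Ω] [RCLike 𝕜] (P : Measure Ω)
    (est : ℕ → Ω → κ → 𝕜) : Prop :=
  (∀ N l, MemLp (fun ω => est N ω l) 2 P) ∧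
    ∀ k l, Tendsto (fun N => covMat P (est N) k l) atTop (𝓝 0)

/-- Statistical consistency: `est N → v` in mean square and in probability. -/
def IsConsistent {Ω κ 𝕜 : Type*} [MeasurableSpace Ω] [RCLike 𝕜] (P : Measure Ω)
    (est : ℕ → Ω → κ → 𝕜) (v : κ → 𝕜) : Prop :=
  ∀ l, Tendsto (fun N => ∫ ω, ‖est N ω l - v l‖ ^ 2 ∂P) atTop (𝓝 0) ∧
    TendstoInMeasure P (fun N ω => est N ω l) atTop (fun _ => v l)

/-- The noncompressive estimate `v̂ = Ψ† û`. -/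
def ncEst {Ω : Type*} {q : ℕ} (a₀ : Fin q) (L : ℕ) (c : Fin q → ℕ) (y : Fin q → ℤ → Ω → ℝ)
    (N : ℕ) (ω : Ω) : Fin L → ℂ :=
  pinv (Psi a₀ L c) *ᵥ (fun i => (corrEst a₀ (delayFilter L c) y N ω i : ℂ))

/-- The noncompressive estimate computed from the stacked real system. -/
def ncEstReal {Ω : Type*} {q : ℕ} (a₀ : Fin q) (L : ℕ) (c : Fin q → ℕ)
    (y : Fin q → ℤ → Ω → ℝ) (N : ℕ) (ω : Ω) : Fin L → ℝ :=
  pinv (PsiReal a₀ L c) *ᵥ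
    stackReIm (fun i => (corrEst a₀ (delayFilter L c) y N ω i : ℂ))

end MultiCoset

end

/-!
The delay by `c_i / W` is a fractional delay by `τ_i = c_i / L < 1` sampling periods of a channel.
In units of that period, a finite linear combination of samples of the process has a trigonometric
polynomial as its symbol, and `E Y Z` is the integral of the product of the symbols (one of them
conjugated) against the spectral density (`HasSpectralDensity.integral_linearCombination_mul`).
This isometry passes to mean-square limits along which the symbols are uniformly bounded and
converge almost everywhere (`HasSymbol.integral_mul`, `HasSpectralDensity.exists_hasSymbol`).

The symmetric partial sums of the frequency response of the delay are uniformly bounded, by the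
boundedness of the partial sums of `∑ sin(2πkφ)/k` (`exists_norm_dSum_symm_le`), and they converge
away from the jumps (`exists_norm_dSum_sub_le`). So the delayed samples `z_i(n)` exist, with symbols
`e^{2πint} e^{2πiτ_i m}` on the subband of index `m`. At lag zero the cross-correlation of `z_a` and
`z_b` is therefore a sum over the subbands of their powers times a phase, which is the linear system
`u = Ψ v` (`corrVec_eq_mulVec`).

The difference `z_i^N(n) - z_i(n)` is an edge effect. Its partial sums are not symmetric, and are not
uniformly bounded; but convolution with the impulse response of the delay is a contraction of `ℓ²`
(`sum_norm_sq_conv_hk_le`), which bounds the time averages of the squared symbols at every frequency.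
By dominated convergence `N⁻¹ ∑_{n<N} E |z_i^N(n) - z_i(n)|²` tends to `0`
(`HasSpectralDensity.tendsto_mean_edge`), and the Cauchy-Schwarz inequality gives asymptotic
unbiasedness.

In the Gaussian case Isserlis' formula (`HasGaussianMoments.integral_mul_mul_mul`) bounds the variance
of a sample correlation by double averages of squared covariances of the `z^N`. Up to edge effects
these covariances are the correlations `r_{z_a z_b}(n - m)`, which tend to `0` at infinity by the
Riemann-Lebesgue lemma since the process has a spectral density (`tendsto_corr_cofinite`), so the
double averages tend to `0` (`tendsto_mean_mean_inner_sq`). The statements on the least-squares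
estimates follow because these are fixed linear images of the sample correlations.
-/

noncomputable section

namespace MultiCoset

/-! ### The Fourier series of an ideal fractional delay -/

/-- The character `t ↦ e^{2πit}`, as a complex-valued function. -/
def ex (t : ℝ) : ℂ := (Real.fourierChar t : ℂ)

lemma ex_eq_exp (t : ℝ) : ex t = Complex.exp (2 * Real.pi * t * Complex.I) := by
  rw [ex, Real.fourierChar_apply]; push_cast; ring_nf

lemma ex_add (s t : ℝ) : ex (s + t) = ex s * ex t := by
  simp [ex, AddChar.map_add_eq_mul]

@[simp] lemma ex_zero : ex 0 = 1 := by simp [ex]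

@[simp] lemma norm_ex (t : ℝ) : ‖ex t‖ = 1 := Circle.norm_coe _

lemma conj_ex (t : ℝ) : conj (ex t) = ex (-t) := by
  simp [ex, AddChar.map_neg_eq_inv]

@[fun_prop] lemma continuous_ex : Continuous ex := by
  rw [show ex = fun t : ℝ => Complex.exp (2 * Real.pi * t * Complex.I) from funext ex_eq_exp]
  fun_prop

lemma ex_intCast (n : ℤ) : ex n = 1 := by
  rw [ex_eq_exp, Complex.exp_eq_one_iff]
  exact ⟨n, by push_cast; ring⟩

lemma ex_add_intCast (t : ℝ) (n : ℤ) : ex (t + n) = ex t := by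
  rw [ex_add, ex_intCast, mul_one]

/-- The factor `1 + e^{2πit}` vanishes only at the jumps of the fractional delay. -/
lemma one_add_ex_ne_zero {t : ℝ} (ht : |t| < 1 / 2) : 1 + ex t ≠ 0 := by
  intro h
  have hre : (ex t).re = Real.cos (2 * Real.pi * t) := by
    rw [ex_eq_exp, show (2 * Real.pi * t * Complex.I : ℂ) = ((2 * Real.pi * t : ℝ) : ℂ) * Complex.I
      by push_cast; ring, Complex.exp_ofReal_mul_I_re]
  have him : (ex t).im = Real.sin (2 * Real.pi * t) := by
    rw [ex_eq_exp, show (2 * Real.pi * t * Complex.I : ℂ) = ((2 * Real.pi * t : ℝ) : ℂ) * Complex.I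
      by push_cast; ring, Complex.exp_ofReal_mul_I_im]
  have h1 : (ex t).re = -1 := by
    have := congrArg Complex.re h
    simp at this; linarith
  have hp := Real.pi_pos
  have h2 := abs_lt.1 ht
  -- `cos (2πt) = 2 cos² (πt) - 1`, and `cos (πt) > 0` for `|t| < 1/2`
  have h3 : 0 < Real.cos (Real.pi * t) :=
    Real.cos_pos_of_mem_Ioo ⟨by nlinarith, by nlinarith⟩
  rw [hre, show 2 * Real.pi * t = 2 * (Real.pi * t) by ring, Real.cos_two_mul] at h1
  nlinarith

lemma integral_ex_mul (a : ℝ) :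
    ∫ t in (-(1 / 2) : ℝ)..(1 / 2), ex (a * t) = (Real.sinc (Real.pi * a) : ℂ) := by
  rcases eq_or_ne a 0 with rfl | ha
  · simp; norm_num
  have hpa : 2 * Real.pi * a ≠ 0 := by
    have := Real.pi_ne_zero
    positivity
  have h := intervalIntegral.integral_comp_mul_left (a := -(1 / 2)) (b := 1 / 2)
    (fun t : ℝ => Complex.exp (t * Complex.I)) hpa
  rw [show 2 * Real.pi * a * (-(1 / 2)) = -(Real.pi * a) by ring,
    show 2 * Real.pi * a * (1 / 2) = Real.pi * a by ring, integral_exp_mul_I_eq_sinc] at h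
  have h' : ∀ t : ℝ, ex (a * t) = Complex.exp (((2 * Real.pi * a * t : ℝ) : ℂ) * Complex.I) := by
    intro t; rw [ex_eq_exp]; push_cast; ring_nf
  simp_rw [h']
  rw [h, Complex.real_smul]
  have : (Real.pi : ℂ) ≠ 0 := by exact_mod_cast Real.pi_ne_zero
  have : (a : ℂ) ≠ 0 := by exact_mod_cast ha
  push_cast
  field_simp

/-- Impulse response `sinc (π (m - τ))` of the ideal delay by the fraction `τ` of a sampling
period. -/
def hk (τ : ℝ) (m : ℤ) : ℝ := Real.sinc (Real.pi * ((m : ℝ) - τ))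

lemma abs_hk_le_one (τ : ℝ) (m : ℤ) : |hk τ m| ≤ 1 := Real.abs_sinc_le_one _

lemma hk_mul (τ : ℝ) (m : ℤ) :
    hk τ m * (Real.pi * (τ - m)) = (-1) ^ m * Real.sin (Real.pi * τ) := by
  have hs : Real.sin (Real.pi * (m - τ)) = -((-1) ^ m * Real.sin (Real.pi * τ)) := by
    rw [show Real.pi * (m - τ) = m * Real.pi - Real.pi * τ by ring, Real.sin_sub,
      Real.sin_int_mul_pi, Real.cos_int_mul_pi]
    ring
  rcases eq_or_ne (Real.pi * ((m : ℝ) - τ)) 0 with h | h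
  · rw [h, Real.sin_zero] at hs
    rw [show Real.pi * (τ - m) = -(Real.pi * (m - τ)) by ring, h]
    linarith
  · rw [hk, Real.sinc_of_ne_zero h, hs]
    have h1 : (m : ℝ) - τ ≠ 0 := right_ne_zero_of_mul h
    have h2 := Real.pi_ne_zero
    field_simp
    ring

/-- Fourier coefficients over a unit interval centred at `0`, in terms of `ex`. -/
lemma fourierCoeffOn_unit (f : ℝ → ℂ) (n : ℤ) (hab : (-(1 / 2) : ℝ) < 1 / 2) :
    fourierCoeffOn hab f n = ∫ t in (-(1 / 2) : ℝ)..(1 / 2), ex (-(n * t)) * f t := by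
  rw [fourierCoeffOn_eq_integral]
  norm_num
  refine intervalIntegral.integral_congr fun t _ => ?_
  rw [show (2 * Real.pi * Complex.I * n * t : ℂ) = 2 * Real.pi * ((n * t : ℝ) : ℂ) * Complex.I by
    push_cast; ring, ← ex_eq_exp, conj_ex]

lemma intervalIntegrable_of_continuous {f : ℝ → ℂ} (hf : Continuous f) (a b : ℝ) :
    IntervalIntegrable f volume a b := hf.intervalIntegrable a b

/-- The Fourier coefficients of `∑_k a_k e^{2πi(k+τ)t}` on `[-1/2, 1/2]` are the values of the
convolution of `a` with the impulse response of the delay. -/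
lemma fourierCoeffOn_trig (τ : ℝ) (N : ℕ) (a : ℕ → ℂ) (n : ℤ) (hab : (-(1 / 2) : ℝ) < 1 / 2) :
    fourierCoeffOn hab (fun t => ∑ k ∈ Finset.range N, a k * ex ((k + τ) * t)) n
      = ∑ k ∈ Finset.range N, a k * hk τ (n - k) := by
  rw [fourierCoeffOn_unit]
  simp_rw [Finset.mul_sum]
  rw [intervalIntegral.integral_finsetSum
    (fun i _ => intervalIntegrable_of_continuous (by fun_prop) _ _)]
  refine Finset.sum_congr rfl fun k _ => ?_
  have : ∀ t : ℝ, ex (-(n * t)) * (a k * ex ((k + τ) * t)) = a k * ex ((k + τ - n) * t) := by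
    intro t
    rw [mul_left_comm, ← ex_add]
    ring_nf
  simp_rw [this]
  rw [intervalIntegral.integral_const_mul, integral_ex_mul, hk, ← Real.sinc_neg]
  congr 3
  push_cast; ring

lemma hk_zero (m : ℤ) : hk 0 m = if m = 0 then 1 else 0 := by
  split_ifs with h
  · simp [hk, h]
  · have h1 := hk_mul 0 m
    simp at h1
    tauto

/-- The delay does not increase energy: convolution with the impulse response is a contraction
in `ℓ²`. -/
lemma sum_norm_sq_conv_hk_le (τ : ℝ) (N : ℕ) (a : ℕ → ℂ) :
    ∑ n ∈ Finset.range N, ‖∑ k ∈ Finset.range N, a k * hk τ ((n : ℤ) - k)‖ ^ 2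
      ≤ ∑ k ∈ Finset.range N, ‖a k‖ ^ 2 := by
  have hab : (-(1 / 2) : ℝ) < 1 / 2 := by norm_num
  have key : ∀ σ : ℝ, HasSum
      (fun n : ℤ => ‖∑ k ∈ Finset.range N, a k * hk σ (n - k)‖ ^ 2)
      (∫ t in (-(1 / 2) : ℝ)..(1 / 2), ‖∑ k ∈ Finset.range N, a k * ex (k * t)‖ ^ 2) := by
    intro σ
    have hc : Continuous fun t : ℝ => ∑ k ∈ Finset.range N, a k * ex ((k + σ) * t) := by fun_prop
    have hmem : MemLp (fun t : ℝ => ∑ k ∈ Finset.range N, a k * ex ((k + σ) * t)) 2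
        (volume.restrict (Set.Ioc (-(1 / 2)) (1 / 2))) :=
      MemLp.of_bound hc.aestronglyMeasurable (∑ k ∈ Finset.range N, ‖a k‖)
        (ae_of_all _ fun t => (norm_sum_le _ _).trans (by simp))
    have h := hasSum_sq_fourierCoeffOn hab hmem
    simp_rw [fourierCoeffOn_trig] at h
    convert h using 1
    norm_num
    refine intervalIntegral.integral_congr fun t _ => ?_
    have : ∑ k ∈ Finset.range N, a k * ex ((k + σ) * t)
        = (∑ k ∈ Finset.range N, a k * ex (k * t)) * ex (σ * t) := by
      rw [Finset.sum_mul]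
      refine Finset.sum_congr rfl fun k _ => ?_
      rw [add_mul, ex_add, mul_assoc]
    simp only [this, norm_mul, norm_ex, mul_one]
  have h0 : HasSum (fun n : ℤ => ‖∑ k ∈ Finset.range N, a k * hk 0 (n - k)‖ ^ 2)
      (∑ k ∈ Finset.range N, ‖a k‖ ^ 2) := by
    have h1 : ∀ n : ℤ, n ∉ (Finset.range N).map Nat.castEmbedding →
        ‖∑ k ∈ Finset.range N, a k * hk 0 (n - k)‖ ^ 2 = 0 := by
      intro n hn
      rw [Finset.sum_eq_zero, norm_zero]
      · norm_num
      intro k hk'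
      rw [hk_zero, if_neg]
      · simp
      intro h
      exact hn (Finset.mem_map.2 ⟨k, hk', by simp; omega⟩)
    have h2 : HasSum _ _ := hasSum_sum_of_ne_finset_zero h1
    convert h2 using 1
    rw [Finset.sum_map]
    refine Finset.sum_congr rfl fun n hn => ?_
    rw [Finset.sum_eq_single n]
    · simp [hk_zero]
    · intro b _ hb
      rw [hk_zero, if_neg]
      · simp
      · simp; omega
    · exact fun h => absurd hn h
  rw [h0.unique (key 0)]
  have := sum_le_hasSum ((Finset.range N).map Nat.castEmbedding) (fun _ _ => by positivity) (key τ)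
  rw [Finset.sum_map] at this
  simpa using this

/-! ### Convergence of the frequency response of the delay -/

/-- The consecutive sums `h(m) + h(m+1)` decay quadratically. -/
lemma summable_hk_add_hk {τ : ℝ} (h0 : 0 ≤ τ) (h1 : τ < 1) :
    Summable fun m : ℤ => hk τ m + hk τ (m + 1) := by
  refine Summable.of_norm_bounded_eventually
    (((Real.summable_one_div_int_pow (p := 2)).2 (by norm_num)).mul_left 4) ?_
  have : ∀ m ∉ (Set.Icc (-2 : ℤ) 2), ‖hk τ m + hk τ (m + 1)‖ ≤ 4 * (1 / (m : ℝ) ^ 2) := by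
    intro m hm
    have hm' : m < -2 ∨ 2 < m := by
      by_contra h; push Not at h; exact hm ⟨h.1, h.2⟩
    have e1 := hk_mul τ m
    have e2 := hk_mul τ (m + 1)
    rw [zpow_add_one₀ (by norm_num)] at e2
    push_cast at e2
    have hpi := Real.pi_gt_three
    have hprod : (m : ℝ) ^ 2 / 4 ≤ (τ - m) * (τ - (m + 1)) := by
      rcases hm' with h | h
      · have : (m : ℝ) ≤ -3 := by exact_mod_cast (show m ≤ -3 by omega)
        nlinarith
      · have : (3 : ℝ) ≤ m := by exact_mod_cast (show 3 ≤ m by omega)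
        nlinarith
    have hmpos : 0 < (m : ℝ) ^ 2 := by
      have : (m : ℝ) ≠ 0 := by exact_mod_cast (show m ≠ 0 by omega)
      positivity
    have hP : 0 < (τ - m) * (τ - (m + 1)) := by linarith
    have e3 : (hk τ m + hk τ (m + 1)) * (Real.pi * ((τ - m) * (τ - (m + 1))))
        = -((-1) ^ m * Real.sin (Real.pi * τ)) := by
      linear_combination (τ - (m + 1)) * e1 + (τ - m) * e2
    have e4 : |hk τ m + hk τ (m + 1)| * (Real.pi * ((τ - m) * (τ - (m + 1)))) ≤ 1 := by
      have h := congrArg abs e3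
      rw [abs_mul, abs_of_pos (by positivity : 0 < Real.pi * ((τ - m) * (τ - (m + 1)))), abs_neg,
        abs_mul, abs_zpow, abs_neg, abs_one, one_zpow, one_mul] at h
      rw [h]
      exact Real.abs_sin_le_one _
    rw [Real.norm_eq_abs, mul_one_div, le_div_iff₀ hmpos]
    have hA := abs_nonneg (hk τ m + hk τ (m + 1))
    nlinarith [mul_le_mul_of_nonneg_left hprod hA, mul_nonneg hA hP.le]
  rw [Filter.eventually_cofinite]
  exact (Set.finite_Icc (-2 : ℤ) 2).subset fun m hm => by_contra fun h => hm (this m h)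

/-- The partial sums `∑_{m=-A}^{B-1} h(m) e^{-2πimt}` of the frequency response of the delay. -/
def dSum (τ : ℝ) (A B : ℕ) (t : ℝ) : ℂ :=
  ∑ k ∈ Finset.range B, (hk τ k : ℂ) * ex (-((k : ℤ) * t)) +
    ∑ k ∈ Finset.range A, (hk τ (-((k : ℤ) + 1)) : ℂ) * ex (-((-((k : ℤ) + 1) : ℤ) * t))

lemma hk_tendsto_zero {τ : ℝ} (h0 : 0 ≤ τ) (h1 : τ < 1) :
    Tendsto (fun k : ℕ => hk τ k) atTop (𝓝 0) ∧
      Tendsto (fun k : ℕ => hk τ (-(k : ℤ))) atTop (𝓝 0) := by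
  have hb : ∀ m : ℤ, |hk τ m| * |τ - m| ≤ 1 := by
    intro m
    have h := congrArg abs (hk_mul τ m)
    rw [abs_mul, abs_mul, abs_mul, abs_zpow, abs_neg, abs_one, one_zpow, one_mul,
      abs_of_pos Real.pi_pos] at h
    have h2 := Real.abs_sin_le_one (Real.pi * τ)
    have h3 := Real.pi_gt_three
    have h4 : 0 ≤ |hk τ m| * |τ - m| := by positivity
    nlinarith
  have hlim : Tendsto (fun k : ℕ => 1 / ((k : ℝ) - 1)) atTop (𝓝 0) := by
    simp_rw [one_div]
    exact tendsto_inv_atTop_zero.comp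
      (tendsto_atTop_add_const_right _ (-1) tendsto_natCast_atTop_atTop)
  have hle : ∀ᶠ k : ℕ in atTop, |hk τ k| ≤ 1 / ((k : ℝ) - 1) ∧
      |hk τ (-(k : ℤ))| ≤ 1 / ((k : ℝ) - 1) := by
    filter_upwards [eventually_ge_atTop 2] with k hk2
    have hk2' : (2 : ℝ) ≤ k := by exact_mod_cast hk2
    have hpos : 0 < (k : ℝ) - 1 := by linarith
    constructor
    · rw [le_div_iff₀ hpos]
      have h := hb k
      refine le_trans (mul_le_mul_of_nonneg_left ?_ (abs_nonneg _)) h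
      rw [abs_sub_comm]
      refine le_trans ?_ (le_abs_self _)
      push_cast; linarith
    · rw [le_div_iff₀ hpos]
      have h := hb (-(k : ℤ))
      refine le_trans (mul_le_mul_of_nonneg_left ?_ (abs_nonneg _)) h
      refine le_trans ?_ (le_abs_self _)
      push_cast; linarith
  constructor
  · exact squeeze_zero_norm' (hle.mono fun k h => h.1) hlim
  · exact squeeze_zero_norm' (hle.mono fun k h => h.2) hlim

/-- Fourier expansion of `(1 + e^{-2πit}) e^{2πiτt}`: the first factor removes the jump of the
second at `±1/2`, so that the series converges absolutely. -/
lemma hasSum_one_add_ex_mul {τ : ℝ} (h0 : 0 ≤ τ) (h1 : τ < 1) {t : ℝ} (ht : |t| < 1 / 2) :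
    HasSum (fun m : ℤ => ((hk τ m + hk τ (m + 1) : ℝ) : ℂ) * ex (m * t))
      ((1 + ex (-t)) * ex (τ * t)) := by
  have : Fact ((0 : ℝ) < 1) := ⟨one_pos⟩
  set g : ℝ → ℂ := fun t => (1 + ex (-t)) * ex (τ * t) with hg
  have hcont : Continuous g := by fun_prop
  have hz : ∀ s : ℝ, ex s = -1 → (1 + ex s) = 0 := fun s hs => by rw [hs]; ring
  have hhalf : ex (1 / 2) = -1 := by
    rw [ex_eq_exp]; push_cast
    rw [show (2 * Real.pi * (1 / 2) * Complex.I : ℂ) = Real.pi * Complex.I by ring,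
      Complex.exp_pi_mul_I]
  have hnhalf : ex (-(1 / 2)) = -1 := by
    have := ex_add_intCast (-(1 / 2)) 1
    rw [← this]; norm_num; simpa using hhalf
  have hper : g (-(1 / 2)) = g (-(1 / 2) + 1) := by
    simp only [hg]
    rw [show -(1 / 2 : ℝ) + 1 = 1 / 2 by norm_num, neg_neg, hz _ hhalf, hz _ hnhalf]
    ring
  let G : C(AddCircle (1 : ℝ), ℂ) :=
    ⟨AddCircle.liftIco 1 (-(1 / 2)) g, AddCircle.liftIco_continuous hper hcont.continuousOn⟩
  have hcoef : ∀ n : ℤ, fourierCoeff G n = ((hk τ n + hk τ (n + 1) : ℝ) : ℂ) := by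
    intro n
    change fourierCoeff (AddCircle.liftIco 1 (-(1 / 2)) g) n = _
    rw [fourierCoeff_liftIco_eq]
    have hab : (-(1 / 2) : ℝ) < 1 / 2 := by norm_num
    have e : ∀ (b : ℝ) (hb : (-(1 / 2) : ℝ) < b), b = 1 / 2 →
        fourierCoeffOn hb g n = fourierCoeffOn hab g n := by
      rintro b hb rfl; rfl
    rw [e _ _ (by norm_num), fourierCoeffOn_unit]
    have : ∀ t : ℝ, ex (-(n * t)) * g t = ex ((τ - n) * t) + ex ((τ - n - 1) * t) := by
      intro t
      simp only [hg]
      rw [show (τ - n) * t = -(n * t) + τ * t by ring,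
        show (τ - n - 1) * t = -(n * t) + (-t + τ * t) by ring]
      simp only [ex_add]
      ring
    simp_rw [this]
    rw [intervalIntegral.integral_add (intervalIntegrable_of_continuous (by fun_prop) _ _)
      (intervalIntegrable_of_continuous (by fun_prop) _ _), integral_ex_mul, integral_ex_mul,
      hk, hk, ← Real.sinc_neg, ← Real.sinc_neg (Real.pi * (τ - n - 1))]
    push_cast
    congr 4 <;> ring
  have hsum : Summable (fourierCoeff G) := by
    have := summable_hk_add_hk h0 h1
    rw [show fourierCoeff G = fun n : ℤ => ((hk τ n + hk τ (n + 1) : ℝ) : ℂ) from funext hcoef]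
    exact Complex.ofRealCLM.summable this
  have h := has_pointwise_sum_fourier_series_of_summable hsum (t : AddCircle (1 : ℝ))
  have hv : G (t : AddCircle (1 : ℝ)) = g t := by
    have h2 := abs_lt.1 ht
    have hm : t ∈ Set.Ico (-(1 / 2) : ℝ) (-(1 / 2) + 1) := ⟨by linarith [h2.1], by linarith [h2.2]⟩
    change AddCircle.liftIco 1 (-(1 / 2)) g (t : AddCircle (1 : ℝ)) = g t
    exact AddCircle.liftIco_coe_apply hm
  rw [hv] at h
  convert h using 2 with n
  rw [hcoef, smul_eq_mul, fourier_coe_apply, ex_eq_exp]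
  congr 2
  push_cast; ring

lemma dSum_sub_intCast (τ : ℝ) (A B : ℕ) (t : ℝ) (j : ℤ) :
    dSum τ A B (t - j) = dSum τ A B t := by
  have : ∀ m : ℤ, ex (-(m * (t - j))) = ex (-(m * t)) := by
    intro m
    have := ex_add_intCast (-(m * t)) (m * j)
    rw [← this]; push_cast; ring_nf
  simp only [dSum, this]

/-- Away from its jumps, the frequency response of the delay is the limit of the partial sums as
the two ends of the range of summation go to infinity independently. -/
lemma exists_norm_dSum_sub_le {τ : ℝ} (h0 : 0 ≤ τ) (h1 : τ < 1) {t : ℝ}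
    (ht : |t - round t| < 1 / 2) :
    ∃ ε : ℕ → ℝ, Tendsto ε atTop (𝓝 0) ∧
      ∀ A B, ‖dSum τ A B t - ex (-(τ * (t - round t)))‖ ≤ ε A + ε B := by
  set u := t - round t with hu
  have hd : ∀ A B, dSum τ A B t = dSum τ A B u := fun A B => (dSum_sub_intCast _ _ _ _ _).symm
  set f : ℤ → ℂ := fun m => hk τ m * ex (-(m * u)) with hf
  set g : ℤ → ℂ := fun m => ((hk τ m + hk τ (m + 1) : ℝ) : ℂ) * ex (-(m * u)) with hg
  have hne : 1 + ex u ≠ 0 := one_add_ex_ne_zero ht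
  have hsum : HasSum g ((1 + ex u) * ex (-(τ * u))) := by
    have := hasSum_one_add_ex_mul h0 h1 (t := -u) (by rwa [abs_neg])
    simpa [hg, neg_neg, mul_neg] using this
  have hgf : ∀ m : ℤ, g m = f m + ex u * f (m + 1) := by
    intro m
    have : ex (-(m * u)) = ex u * ex (-((m + 1 : ℤ) * u)) := by
      rw [← ex_add]; push_cast; ring_nf
    simp only [hg, hf]
    push_cast at this ⊢
    linear_combination (hk τ (m + 1) : ℂ) * this
  have hpos : ∀ B : ℕ, (1 + ex u) * ∑ k ∈ Finset.range B, f k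
      = ∑ k ∈ Finset.range B, g k + ex u * f 0 - ex u * f B := by
    intro B
    induction B with
    | zero => simp
    | succ B ih =>
      rw [Finset.sum_range_succ, Finset.sum_range_succ, mul_add, ih, hgf B]
      push_cast
      ring
  have hneg : ∀ A : ℕ, (1 + ex u) * ∑ k ∈ Finset.range A, f (-((k : ℤ) + 1))
      = ∑ k ∈ Finset.range A, g (-((k : ℤ) + 1)) + ex u * f (-(A : ℤ)) - ex u * f 0 := by
    intro A
    induction A with
    | zero => simp
    | succ A ih =>
      rw [Finset.sum_range_succ, Finset.sum_range_succ, mul_add, ih, hgf (-((A : ℤ) + 1)),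
        show -((A : ℤ) + 1) + 1 = -(A : ℤ) by ring]
      push_cast
      ring
  obtain ⟨l1, l2⟩ := hk_tendsto_zero h0 h1
  have hfp : Tendsto (fun B : ℕ => f B) atTop (𝓝 0) := by
    rw [tendsto_zero_iff_norm_tendsto_zero] at l1 ⊢
    simpa [hf] using l1
  have hfn : Tendsto (fun B : ℕ => f (-(B : ℤ))) atTop (𝓝 0) := by
    rw [tendsto_zero_iff_norm_tendsto_zero] at l2 ⊢
    simpa [hf] using l2
  have hgs := hsum.summable
  have hg1 : Summable fun k : ℕ => g k := hgs.comp_injective Nat.cast_injective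
  have hg2 : Summable fun k : ℕ => g (-((k : ℤ) + 1)) :=
    hgs.comp_injective (i := fun k : ℕ => -((k : ℤ) + 1)) fun a b h => by
      simp only at h; omega
  have htot := (hg1.hasSum.of_nat_of_neg_add_one hg2.hasSum).unique hsum
  have hlim1 : Tendsto (fun B : ℕ => ∑ k ∈ Finset.range B, f k) atTop
      (𝓝 ((1 + ex u)⁻¹ * (∑' k : ℕ, g k + ex u * f 0))) := by
    have h := ((hg1.hasSum.tendsto_sum_nat.add_const (ex u * f 0)).sub
      (hfp.const_mul (ex u))).const_mul (1 + ex u)⁻¹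
    rw [mul_zero, sub_zero] at h
    refine h.congr fun B => ?_
    rw [← hpos B, inv_mul_cancel_left₀ hne]
  have hlim2 : Tendsto (fun A : ℕ => ∑ k ∈ Finset.range A, f (-((k : ℤ) + 1))) atTop
      (𝓝 ((1 + ex u)⁻¹ * (∑' k : ℕ, g (-((k : ℤ) + 1)) - ex u * f 0))) := by
    have h := ((hg2.hasSum.tendsto_sum_nat.add (hfn.const_mul (ex u))).sub_const
      (ex u * f 0)).const_mul (1 + ex u)⁻¹
    rw [mul_zero, add_zero] at h
    refine h.congr fun A => ?_
    rw [← hneg A, inv_mul_cancel_left₀ hne]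
  refine ⟨fun k => ‖∑ j ∈ Finset.range k, f j - (1 + ex u)⁻¹ * (∑' k : ℕ, g k + ex u * f 0)‖ +
    ‖∑ j ∈ Finset.range k, f (-((j : ℤ) + 1)) -
      (1 + ex u)⁻¹ * (∑' k : ℕ, g (-((k : ℤ) + 1)) - ex u * f 0)‖, ?_, fun A B => ?_⟩
  · have e1 := (tendsto_iff_norm_sub_tendsto_zero.1 hlim1)
    have e2 := (tendsto_iff_norm_sub_tendsto_zero.1 hlim2)
    simpa using e1.add e2
  · have e : dSum τ A B t - ex (-(τ * u)) =
        (∑ j ∈ Finset.range B, f j - (1 + ex u)⁻¹ * (∑' k : ℕ, g k + ex u * f 0)) +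
        (∑ j ∈ Finset.range A, f (-((j : ℤ) + 1)) -
          (1 + ex u)⁻¹ * (∑' k : ℕ, g (-((k : ℤ) + 1)) - ex u * f 0)) := by
      have h3 : ex (-(τ * u)) = (1 + ex u)⁻¹ * (∑' k : ℕ, g k + ∑' k : ℕ, g (-((k : ℤ) + 1))) := by
        rw [htot, inv_mul_cancel_left₀ hne]
      rw [h3, hd]
      simp only [dSum, hf, Int.cast_natCast]
      ring
    rw [e]
    refine (norm_add_le _ _).trans ?_
    have a1 := norm_nonneg (∑ j ∈ Finset.range A, f j -
      (1 + ex u)⁻¹ * (∑' k : ℕ, g k + ex u * f 0))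
    have a2 := norm_nonneg (∑ j ∈ Finset.range B, f (-((j : ℤ) + 1)) -
      (1 + ex u)⁻¹ * (∑' k : ℕ, g (-((k : ℤ) + 1)) - ex u * f 0))
    linarith

lemma ae_abs_sub_round_lt : ∀ᵐ t : ℝ, |t - round t| < 1 / 2 := by
  have hc : (Set.range (fun n : ℤ => (n : ℝ) + 1 / 2) ∪
      Set.range (fun n : ℤ => (n : ℝ) - 1 / 2)).Countable :=
    (Set.countable_range _).union (Set.countable_range _)
  filter_upwards [compl_mem_ae_iff.2 (hc.measure_zero volume)] with t ht
  refine lt_of_le_of_ne (abs_sub_round t) fun h => ht ?_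
  rcases (abs_eq (by norm_num)).1 h with h | h
  · exact Or.inl ⟨round t, by simp only; linarith⟩
  · exact Or.inr ⟨round t, by simp only; linarith⟩

/-! ### Boundedness of the symmetric partial sums -/

/-- Tails of the sawtooth series, by summation by parts. -/
lemma abs_sum_sin_div_mul_sin_le (φ : ℝ) (K M : ℕ) :
    |2 * Real.sin (Real.pi * φ) * ∑ k ∈ Finset.range M,
      Real.sin (2 * Real.pi * (K + k + 1) * φ) / (K + k + 1)| ≤ 2 / (K + 1) := by
  set c : ℕ → ℝ := fun k => Real.cos (Real.pi * (2 * (K + k) + 1) * φ) with hc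
  have hcb : ∀ k, |c k| ≤ 1 := fun k => Real.abs_cos_le_one _
  -- the Abel-summed form: adding the boundary term makes the increments summable
  have key : ∀ M : ℕ, |2 * Real.sin (Real.pi * φ) * ∑ k ∈ Finset.range M,
      Real.sin (2 * Real.pi * (K + k + 1) * φ) / (K + k + 1) + c M / (K + M + 1)|
      ≤ 2 / (K + 1) - 1 / (K + M + 1) := by
    intro M
    induction M with
    | zero =>
      have hK : (0 : ℝ) < K + 1 := by positivity
      simp only [Finset.range_zero, Finset.sum_empty, mul_zero, zero_add, Nat.cast_zero, add_zero]
      rw [abs_div, abs_of_pos hK, ← sub_div]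
      exact div_le_div_of_nonneg_right (by linarith [hcb 0]) hK.le
    | succ M ih =>
      have hK1 : (0 : ℝ) < K + M + 1 := by positivity
      have hK2 : (0 : ℝ) < K + M + 2 := by positivity
      have hs : 2 * Real.sin (Real.pi * φ) * Real.sin (2 * Real.pi * (K + M + 1) * φ)
          = c M - c (M + 1) := by
        simp only [hc]
        rw [show Real.pi * (2 * (K + M) + 1) * φ
            = 2 * Real.pi * (K + M + 1) * φ - Real.pi * φ by ring,
          show Real.pi * (2 * ((K : ℝ) + ((M + 1 : ℕ) : ℝ)) + 1) * φ
            = 2 * Real.pi * (K + M + 1) * φ + Real.pi * φ by push_cast; ring,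
          Real.cos_sub, Real.cos_add]
        ring
      have e : 2 * Real.sin (Real.pi * φ) * ∑ k ∈ Finset.range (M + 1),
          Real.sin (2 * Real.pi * (K + k + 1) * φ) / (K + k + 1)
            + c (M + 1) / (K + (M + 1 : ℕ) + 1)
          = (2 * Real.sin (Real.pi * φ) * ∑ k ∈ Finset.range M,
            Real.sin (2 * Real.pi * (K + k + 1) * φ) / (K + k + 1) + c M / (K + M + 1))
            - c (M + 1) * (1 / (K + M + 1) - 1 / (K + M + 2)) := by
        rw [Finset.sum_range_succ, mul_add, ← mul_div_assoc, hs]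
        push_cast
        rw [show (K : ℝ) + (M + 1) + 1 = K + M + 2 by ring]
        ring
      rw [e]
      have hpos : 0 ≤ 1 / ((K : ℝ) + M + 1) - 1 / (K + M + 2) := by
        rw [sub_nonneg]
        exact one_div_le_one_div_of_le hK1 (by linarith)
      have hb : |c (M + 1) * (1 / ((K : ℝ) + M + 1) - 1 / (K + M + 2))|
          ≤ 1 / ((K : ℝ) + M + 1) - 1 / (K + M + 2) := by
        rw [abs_mul, abs_of_nonneg hpos]
        exact mul_le_of_le_one_left hpos (hcb _)
      refine (abs_sub _ _).trans ?_
      push_cast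
      rw [show (K : ℝ) + (M + 1) + 1 = K + M + 2 by ring]
      linarith
  have h1 := key M
  have hK1 : (0 : ℝ) < K + M + 1 := by positivity
  have h2 : |c M / (K + M + 1)| ≤ 1 / (K + M + 1) := by
    rw [abs_div, abs_of_pos hK1]
    exact div_le_div_of_nonneg_right (hcb M) hK1.le
  have h3 := abs_sub (2 * Real.sin (Real.pi * φ) * ∑ k ∈ Finset.range M,
      Real.sin (2 * Real.pi * (K + k + 1) * φ) / (K + k + 1) + c M / (K + M + 1))
      (c M / (K + M + 1))
  rw [add_sub_cancel_right] at h3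
  linarith

/-- The partial sums of the sawtooth series `∑ sin(2πkφ)/k` are uniformly bounded. -/
lemma abs_sum_sin_div_le (φ : ℝ) (M : ℕ) :
    |∑ k ∈ Finset.range M, Real.sin (2 * Real.pi * (k + 1) * φ) / (k + 1)| ≤ 8 := by
  have hpi := Real.pi_pos
  -- reduction to `0 < φ ≤ 1/2` by periodicity and oddness
  suffices H : ∀ φ : ℝ, 0 < φ → φ ≤ 1 / 2 →
      |∑ k ∈ Finset.range M, Real.sin (2 * Real.pi * (k + 1) * φ) / (k + 1)| ≤ 8 by
    have hper : ∑ k ∈ Finset.range M, Real.sin (2 * Real.pi * (k + 1) * φ) / (k + 1)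
        = ∑ k ∈ Finset.range M, Real.sin (2 * Real.pi * (k + 1) * (φ - round φ)) / (k + 1) := by
      refine Finset.sum_congr rfl fun k _ => ?_
      rw [show 2 * Real.pi * (k + 1) * (φ - round φ)
        = 2 * Real.pi * (k + 1) * φ - (((k + 1 : ℕ) : ℤ) * round φ : ℤ) * (2 * Real.pi) by
          push_cast; ring, Real.sin_sub_int_mul_two_pi]
    rw [hper]
    have hle := abs_le.1 (abs_sub_round φ)
    rcases lt_trichotomy (φ - round φ) 0 with h | h | h
    · have := H (-(φ - round φ)) (by linarith) (by linarith [hle.1])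
      simp only [mul_neg, Real.sin_neg, neg_div, Finset.sum_neg_distrib, abs_neg] at this
      exact this
    · simp [h]
    · exact H _ h hle.2
  intro φ hφ hφ2
  have hterm : ∀ k : ℕ, |Real.sin (2 * Real.pi * (k + 1) * φ) / (k + 1)| ≤ 2 * Real.pi * φ := by
    intro k
    have hk : (0 : ℝ) < k + 1 := by positivity
    rw [abs_div, abs_of_pos hk, div_le_iff₀ hk]
    refine Real.abs_sin_le_abs.trans ?_
    rw [abs_of_pos (by positivity)]
    exact le_of_eq (by ring)
  have hinit : ∀ K : ℕ, (K : ℝ) * φ ≤ 1 →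
      |∑ k ∈ Finset.range K, Real.sin (2 * Real.pi * (k + 1) * φ) / (k + 1)| ≤ 7 := by
    intro K hK
    refine (Finset.abs_sum_le_sum_abs _ _).trans ((Finset.sum_le_sum fun k _ => hterm k).trans ?_)
    rw [Finset.sum_const, Finset.card_range, nsmul_eq_mul]
    nlinarith [Real.pi_lt_d2]
  -- the terms with index below `1/φ` are bounded one by one, the others by partial summation
  set K := ⌊1 / φ⌋₊ with hKdef
  have hK1 : (K : ℝ) * φ ≤ 1 := by
    have := Nat.floor_le (show 0 ≤ 1 / φ by positivity)
    rwa [le_div_iff₀ hφ] at this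
  have hK2 : 1 ≤ ((K : ℝ) + 1) * φ := by
    have := (Nat.lt_floor_add_one (1 / φ)).le
    rwa [div_le_iff₀ hφ] at this
  rcases le_total M K with hMK | hMK
  · have : (M : ℝ) * φ ≤ 1 := by
      have : (M : ℝ) ≤ K := by exact_mod_cast hMK
      nlinarith
    linarith [hinit M this]
  · obtain ⟨m, rfl⟩ := Nat.exists_eq_add_of_le hMK
    rw [Finset.sum_range_add]
    refine (abs_add_le _ _).trans ?_
    have h1 := hinit K hK1
    have h2 := abs_sum_sin_div_mul_sin_le φ K m
    have hsin : 2 * φ ≤ Real.sin (Real.pi * φ) := by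
      have := Real.mul_le_sin (x := Real.pi * φ) (by positivity) (by nlinarith)
      rwa [show 2 / Real.pi * (Real.pi * φ) = 2 * φ by field_simp] at this
    push_cast
    rw [abs_mul, abs_of_pos (by linarith : 0 < 2 * Real.sin (Real.pi * φ)),
      le_div_iff₀ (by positivity)] at h2
    set Q := |∑ k ∈ Finset.range m, Real.sin (2 * Real.pi * (K + k + 1) * φ) / (K + k + 1)| with hQ
    have hQ0 : 0 ≤ Q := abs_nonneg _
    have h3 : 4 * Q ≤ 2 * Real.sin (Real.pi * φ) * Q * (K + 1) := by
      have : 2 ≤ Real.sin (Real.pi * φ) * (K + 1) := by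
        have hk0 : (0 : ℝ) ≤ K := Nat.cast_nonneg _
        nlinarith
      nlinarith
    linarith

/-- The symmetric partial sums of the frequency response of the delay are uniformly bounded. -/
lemma exists_norm_dSum_symm_le {τ : ℝ} (h0 : 0 ≤ τ) (h1 : τ < 1) :
    ∃ C : ℝ, ∀ (M : ℕ) (t : ℝ), ‖dSum τ M (M + 1) t‖ ≤ C := by
  have hz : Summable fun k : ℕ => 1 / ((k : ℝ) + 1) ^ 2 := by
    have := (summable_nat_add_iff 1).2 (Real.summable_one_div_nat_pow.2 (show 1 < 2 by norm_num))
    simpa using this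
  set Z := ∑' k : ℕ, 1 / ((k : ℝ) + 1) ^ 2
  have hpi := Real.pi_gt_three
  set s := Real.sin (Real.pi * τ) with hs
  have hs1 : |s| ≤ 1 := Real.abs_sin_le_one _
  refine ⟨1 + 16 + (1 / (1 - τ) + 1) * Z, fun M t => ?_⟩
  set f : ℤ → ℂ := fun m => hk τ m * ex (-(m * t)) with hf
  -- splitting of the pair of terms with indices `±(k+1)`
  have hpair : ∀ k : ℕ, ‖f ((k : ℤ) + 1) + f (-((k : ℤ) + 1)) - ((2 * s / Real.pi *
      (Real.sin (2 * Real.pi * (k + 1) * (t + 1 / 2)) / (k + 1)) : ℝ) : ℂ) * Complex.I‖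
      ≤ (1 / (1 - τ) + 1) * (1 / ((k : ℝ) + 1) ^ 2) := by
    intro k
    set m : ℝ := (k : ℝ) + 1 with hm
    have hm1 : 1 ≤ m := by rw [hm]; have : (0 : ℝ) ≤ k := Nat.cast_nonneg _; linarith
    have hsin : Real.sin (2 * Real.pi * m * (t + 1 / 2))
        = (-1) ^ (k + 1) * Real.sin (2 * Real.pi * m * t) := by
      rw [show 2 * Real.pi * m * (t + 1 / 2) = 2 * Real.pi * m * t + ((k + 1 : ℕ) : ℝ) * Real.pi by
        rw [hm]; push_cast; ring, Real.sin_add_nat_mul_pi]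
    have hexs : ex (m * t) - ex (-(m * t)) = 2 * Real.sin (2 * Real.pi * m * t) * Complex.I := by
      rw [ex_eq_exp, ex_eq_exp, Complex.ofReal_sin, Complex.sin]
      push_cast
      rw [show (2 * Real.pi * (m * t) * Complex.I : ℂ) = 2 * Real.pi * m * t * Complex.I by ring,
        show (2 * Real.pi * -(m * t) * Complex.I : ℂ) = -(2 * Real.pi * m * t) * Complex.I by ring]
      linear_combination (Complex.exp (2 * Real.pi * m * t * Complex.I)
        - Complex.exp (-(2 * Real.pi * m * t) * Complex.I)) * Complex.I_mul_I
    have e1 := hk_mul τ ((k : ℤ) + 1)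
    have e2 := hk_mul τ (-((k : ℤ) + 1))
    have hsgn1 : ((-1 : ℝ)) ^ ((k : ℤ) + 1) = (-1) ^ (k + 1) := by
      exact_mod_cast zpow_natCast (-1 : ℝ) (k + 1)
    have hsgn2 : ((-1 : ℝ)) ^ (-((k : ℤ) + 1)) = (-1) ^ (k + 1) := by
      rw [zpow_neg, hsgn1, ← inv_pow]; norm_num
    rw [hsgn1, ← hs] at e1
    rw [hsgn2, ← hs] at e2
    push_cast at e1 e2
    rw [← hm] at e1 e2
    set σ : ℝ := (-1) ^ (k + 1) with hσ
    have hσ1 : |σ| = 1 := by rw [hσ, abs_pow]; norm_num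
    have hmτ : 0 < m - τ := by linarith
    have hmτ' : 0 < m + τ := by linarith
    have f1 : hk τ ((k : ℤ) + 1) = - (σ * s / Real.pi) / m - σ * s / Real.pi * (τ / (m * (m - τ))) := by
      have : τ - m ≠ 0 := by linarith
      have hm0 : m ≠ 0 := by linarith
      have hx : hk τ ((k : ℤ) + 1) = σ * s / (Real.pi * (τ - m)) := by
        rw [eq_div_iff (by positivity)]; exact e1
      rw [hx]
      have : m - τ ≠ 0 := by linarith
      rw [show τ - m = -(m - τ) by ring]
      field_simp
      ring
    have f2 : hk τ (-((k : ℤ) + 1)) = (σ * s / Real.pi) / m - σ * s / Real.pi * (τ / (m * (m + τ))) := by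
      have hm0 : m ≠ 0 := by linarith
      have hx : hk τ (-((k : ℤ) + 1)) = σ * s / (Real.pi * (τ + m)) := by
        rw [eq_div_iff (by positivity), ← e2]; ring
      rw [hx]
      rw [show τ + m = m + τ by ring]
      field_simp
      ring
    have e : f ((k : ℤ) + 1) + f (-((k : ℤ) + 1)) - ((2 * s / Real.pi *
        (Real.sin (2 * Real.pi * m * (t + 1 / 2)) / m) : ℝ) : ℂ) * Complex.I
        = -((σ * s / Real.pi * (τ / (m * (m - τ))) : ℝ) : ℂ) * ex (-(m * t))
          - ((σ * s / Real.pi * (τ / (m * (m + τ))) : ℝ) : ℂ) * ex (m * t) := by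
      simp only [hf]
      rw [f1, f2, hsin]
      have g1 : ex (-(((((k : ℤ) + 1 : ℤ)) : ℝ) * t)) = ex (-(m * t)) := by push_cast; rfl
      have g2 : ex (-((((-((k : ℤ) + 1) : ℤ)) : ℝ) * t)) = ex (m * t) := by
        push_cast; rw [hm]; congr 1; ring
      rw [g1, g2]
      generalize Real.sin (2 * Real.pi * m * t) = y at hexs ⊢
      push_cast
      linear_combination (σ * s / Real.pi / m : ℂ) * hexs
    rw [e]
    have hb : |σ * s / Real.pi| ≤ 1 := by
      rw [abs_div, abs_mul, hσ1, one_mul, abs_of_pos (by linarith : 0 < Real.pi),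
        div_le_one (by linarith)]
      linarith
    have b1 : |σ * s / Real.pi * (τ / (m * (m - τ)))| ≤ 1 / (1 - τ) * (1 / m ^ 2) := by
      rw [abs_mul, abs_of_nonneg (by positivity : 0 ≤ τ / (m * (m - τ)))]
      refine (mul_le_of_le_one_left (by positivity) hb).trans ?_
      rw [div_mul_div_comm, one_mul, div_le_div_iff₀ (by positivity)
        (mul_pos (by linarith) (by positivity))]
      have : (1 - τ) * m ≤ m - τ := by nlinarith
      have h5 : τ * ((1 - τ) * m ^ 2) ≤ 1 * ((1 - τ) * m ^ 2) :=
        mul_le_mul_of_nonneg_right h1.le (mul_nonneg (by linarith) (by positivity))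
      nlinarith [mul_le_mul_of_nonneg_left this (by linarith : 0 ≤ m)]
    have b2 : |σ * s / Real.pi * (τ / (m * (m + τ)))| ≤ 1 / m ^ 2 := by
      rw [abs_mul, abs_of_nonneg (by positivity : 0 ≤ τ / (m * (m + τ)))]
      refine (mul_le_of_le_one_left (by positivity) hb).trans ?_
      rw [div_le_div_iff₀ (by positivity) (by positivity)]
      nlinarith [mul_nonneg h0 (by linarith : 0 ≤ m), sq_nonneg m]
    refine (norm_sub_le _ _).trans ?_
    rw [norm_mul, norm_mul, norm_neg, norm_ex, norm_ex, mul_one, mul_one, Complex.norm_real,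
      Complex.norm_real, Real.norm_eq_abs, Real.norm_eq_abs]
    linarith
  have hdec : dSum τ M (M + 1) t = f 0 +
      ((2 * s / Real.pi * ∑ k ∈ Finset.range M,
        Real.sin (2 * Real.pi * (k + 1) * (t + 1 / 2)) / (k + 1) : ℝ) : ℂ) * Complex.I +
      ∑ k ∈ Finset.range M, (f ((k : ℤ) + 1) + f (-((k : ℤ) + 1)) - ((2 * s / Real.pi *
        (Real.sin (2 * Real.pi * (k + 1) * (t + 1 / 2)) / (k + 1)) : ℝ) : ℂ) * Complex.I) := by
    rw [Finset.sum_sub_distrib, Finset.sum_add_distrib, dSum, Finset.sum_range_succ', Finset.mul_sum,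
      Complex.ofReal_sum, Finset.sum_mul]
    simp only [hf]
    push_cast
    ring
  rw [hdec]
  refine (norm_add₃_le).trans ?_
  gcongr
  · simp only [hf, norm_mul, norm_ex, mul_one, Complex.norm_real]
    exact abs_hk_le_one _ _
  · rw [norm_mul, Complex.norm_I, mul_one, Complex.norm_real, Real.norm_eq_abs, abs_mul]
    have h2 := abs_sum_sin_div_le (t + 1 / 2) M
    have h3 : |2 * s / Real.pi| ≤ 2 := by
      rw [abs_div, abs_mul, abs_of_pos (by linarith : 0 < Real.pi), div_le_iff₀ (by linarith),
        abs_two]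
      nlinarith
    calc _ ≤ 2 * (8 : ℝ) := mul_le_mul h3 h2 (abs_nonneg _) (by norm_num)
      _ = 16 := by norm_num
  · refine (norm_sum_le _ _).trans ((Finset.sum_le_sum fun k _ => hpair k).trans ?_)
    rw [← Finset.mul_sum]
    refine mul_le_mul_of_nonneg_left (hz.sum_le_tsum _ fun _ _ => by positivity) ?_
    have : 0 < 1 - τ := by linarith
    positivity

/-! ### The edge effect of a finite window -/

/-- The spectral response of the windowed and delayed data at time `n < N` is a partial sum of the
frequency response of the delay. -/
lemma sum_hk_mul_ex (τ : ℝ) {N n : ℕ} (hn : n < N) (t : ℝ) :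
    ∑ k ∈ Finset.range N, (hk τ ((n : ℤ) - k) : ℂ) * ex ((k + τ) * t)
      = ex ((n + τ) * t) * dSum τ (N - 1 - n) (n + 1) t := by
  obtain ⟨m, rfl⟩ : ∃ m, N = (n + 1) + m := ⟨N - (n + 1), by omega⟩
  rw [Finset.sum_range_add, ← Finset.sum_range_reflect, dSum, mul_add, Finset.mul_sum,
    Finset.mul_sum, show n + 1 + m - 1 - n = m by omega]
  congr 1
  · refine Finset.sum_congr rfl fun k hk' => ?_
    have hle : k ≤ n := by have := Finset.mem_range.1 hk'; omega
    rw [show n + 1 - 1 - k = n - k by omega, Nat.cast_sub hle, Nat.cast_sub hle,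
      mul_left_comm, ← ex_add]
    push_cast
    ring_nf
  · refine Finset.sum_congr rfl fun k _ => ?_
    rw [mul_left_comm, ← ex_add]
    push_cast
    ring_nf

/-- Time averages of the squared edge effect vanish away from the jumps. -/
lemma tendsto_mean_norm_sq_dSum_sub {τ : ℝ} (h0 : 0 ≤ τ) (h1 : τ < 1) {t : ℝ}
    (ht : |t - round t| < 1 / 2) :
    Tendsto (fun N : ℕ => (N : ℝ)⁻¹ * ∑ n ∈ Finset.range N,
      ‖dSum τ (N - 1 - n) (n + 1) t - ex (-(τ * (t - round t)))‖ ^ 2) atTop (𝓝 0) := by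
  obtain ⟨ε, hε, hb⟩ := exists_norm_dSum_sub_le h0 h1 ht
  have hc1 : Tendsto (fun n => ε n ^ 2) atTop (𝓝 0) := by simpa using hε.pow 2
  have hc2 : Tendsto (fun n => ε (n + 1) ^ 2) atTop (𝓝 0) := (tendsto_add_atTop_iff_nat 1).2 hc1
  have hlim : Tendsto (fun N : ℕ => 2 * ((N : ℝ)⁻¹ * ∑ n ∈ Finset.range N, ε n ^ 2) +
      2 * ((N : ℝ)⁻¹ * ∑ n ∈ Finset.range N, ε (n + 1) ^ 2)) atTop (𝓝 0) := by
    simpa using (hc1.cesaro.const_mul 2).add (hc2.cesaro.const_mul 2)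
  refine squeeze_zero (fun N => by positivity) (fun N => ?_) hlim
  have hrefl := Finset.sum_range_reflect (fun n => ε n ^ 2) N
  rw [← hrefl, mul_left_comm, mul_left_comm 2, ← mul_add, Finset.mul_sum _ _ (2 : ℝ),
    Finset.mul_sum _ _ (2 : ℝ), ← Finset.sum_add_distrib]
  refine mul_le_mul_of_nonneg_left (Finset.sum_le_sum fun n _ => ?_) (by positivity)
  have h := hb (N - 1 - n) (n + 1)
  have h2 := pow_le_pow_left₀ (norm_nonneg _) h 2
  nlinarith [sq_nonneg (ε (N - 1 - n) - ε (n + 1))]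

/-! ### The spectral representation of linear functionals of a stationary process -/

section L2

variable {Ω : Type*} [MeasurableSpace Ω] {P : Measure Ω}

lemma inner_toLp_eq_integral {f g : Ω → ℝ} (hf : MemLp f 2 P) (hg : MemLp g 2 P) :
    inner ℝ (hf.toLp f) (hg.toLp g) = ∫ ω, f ω * g ω ∂P := by
  rw [L2.inner_def]
  refine integral_congr_ae ?_
  filter_upwards [hf.coeFn_toLp, hg.coeFn_toLp] with ω h1 h2
  rw [h1, h2]
  exact mul_comm _ _

lemma norm_toLp_sq_eq_integral {f : Ω → ℝ} (hf : MemLp f 2 P) :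
    ‖hf.toLp f‖ ^ 2 = ∫ ω, f ω ^ 2 ∂P := by
  rw [← real_inner_self_eq_norm_sq, inner_toLp_eq_integral]
  simp_rw [sq]

lemma tendsto_integral_mul_of_tendsto_eLpNorm {ι : Type*} {l : Filter ι} {f g : ι → Ω → ℝ}
    {f' g' : Ω → ℝ}
    (hf : ∀ k, MemLp (f k) 2 P) (hg : ∀ k, MemLp (g k) 2 P) (hf' : MemLp f' 2 P)
    (hg' : MemLp g' 2 P) (h1 : Tendsto (fun k => eLpNorm (f k - f') 2 P) l (𝓝 0))
    (h2 : Tendsto (fun k => eLpNorm (g k - g') 2 P) l (𝓝 0)) :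
    Tendsto (fun k => ∫ ω, f k ω * g k ω ∂P) l (𝓝 (∫ ω, f' ω * g' ω ∂P)) := by
  rw [← Lp.tendsto_Lp_iff_tendsto_eLpNorm'' f hf f' hf'] at h1
  rw [← Lp.tendsto_Lp_iff_tendsto_eLpNorm'' g hg g' hg'] at h2
  have := h1.inner (𝕜 := ℝ) h2
  simpa only [inner_toLp_eq_integral] using this

end L2

/-- The symbol `∑ a_T e^{2πiTt}` of the finite linear combination `∑ a_T X(T)`. -/
def sym (a : ℝ →₀ ℝ) : ℝ → ℂ := Finsupp.linearCombination ℝ (fun T t : ℝ => ex (T * t)) a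

lemma sym_single (T c t : ℝ) : sym (Finsupp.single T c) t = c * ex (T * t) := by
  simp [sym]

lemma sym_sub (a b : ℝ →₀ ℝ) (t : ℝ) : sym (a - b) t = sym a t - sym b t := by
  simp [sym, map_sub]

lemma sym_add (a b : ℝ →₀ ℝ) (t : ℝ) : sym (a + b) t = sym a t + sym b t := by
  simp [sym, map_add]

lemma sym_sum {ι : Type*} (s : Finset ι) (a : ι → ℝ →₀ ℝ) (t : ℝ) :
    sym (∑ i ∈ s, a i) t = ∑ i ∈ s, sym (a i) t := by
  simp [sym, map_sum, Finset.sum_apply]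

lemma continuous_sym (a : ℝ →₀ ℝ) : Continuous (sym a) := by
  induction a using Finsupp.induction_linear with
  | zero => rw [sym, map_zero]; exact continuous_zero
  | add a b ha hb => exact (ha.add hb).congr fun t => (sym_add a b t).symm
  | single T c =>
    have : Continuous fun t : ℝ => (c : ℂ) * ex (T * t) := by fun_prop
    exact this.congr fun t => (sym_single T c t).symm

lemma exists_norm_sym_le (a : ℝ →₀ ℝ) : ∃ C, ∀ t, ‖sym a t‖ ≤ C := by
  induction a using Finsupp.induction_linear with
  | zero => exact ⟨0, by simp [sym]⟩
  | add a b ha hb =>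
    obtain ⟨C, hC⟩ := ha
    obtain ⟨D, hD⟩ := hb
    exact ⟨C + D, fun t => by
      rw [sym_add]; exact (norm_add_le _ _).trans (add_le_add (hC t) (hD t))⟩
  | single T c => exact ⟨|c|, fun t => by rw [sym_single]; simp⟩

/-- `s` is an integrable (possibly signed) spectral density of the square-integrable process `X`,
the frequency `t` being measured in cycles per unit of time. -/
structure HasSpectralDensity {Ω : Type*} [MeasurableSpace Ω] (P : Measure Ω)
    (X : ℝ → Ω → ℝ) (s : ℝ → ℝ) : Prop where
  memLp : ∀ T, MemLp (X T) 2 P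
  integrable : Integrable s
  cov : ∀ T T', ((∫ ω, X T ω * X T' ω ∂P : ℝ) : ℂ) = ∫ t, (s t : ℂ) * ex ((T - T') * t)

/-- The random variable `Y` is a mean-square limit of finite linear combinations of the process,
whose symbols are uniformly bounded and converge to `φ` almost everywhere. -/
structure HasSymbol {Ω : Type*} [MeasurableSpace Ω] (P : Measure Ω) (X : ℝ → Ω → ℝ)
    (Y : Ω → ℝ) (φ : ℝ → ℂ) : Prop where
  memLp : MemLp Y 2 P
  exists_approx : ∃ (a : ℕ → ℝ →₀ ℝ) (C : ℝ), (∀ k t, ‖sym (a k) t‖ ≤ C) ∧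
    (∀ᵐ t, Tendsto (fun k => sym (a k) t) atTop (𝓝 (φ t))) ∧
    Tendsto (fun k => eLpNorm (Finsupp.linearCombination ℝ X (a k) - Y) 2 P) atTop (𝓝 0)

section Spectral

variable {Ω : Type*} [MeasurableSpace Ω] {P : Measure Ω} {X : ℝ → Ω → ℝ} {s : ℝ → ℝ}

lemma HasSpectralDensity.memLp_linearCombination (hX : HasSpectralDensity P X s) (a : ℝ →₀ ℝ) :
    MemLp (Finsupp.linearCombination ℝ X a) 2 P := by
  induction a using Finsupp.induction_linear with
  | zero => simp
  | add a b ha hb => rw [map_add]; exact ha.add hb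
  | single T c => rw [Finsupp.linearCombination_single]; exact (hX.memLp T).const_smul c

lemma HasSpectralDensity.integrable_mul_of_bounded (hX : HasSpectralDensity P X s) {φ : ℝ → ℂ}
    (hφ : AEStronglyMeasurable φ) {C : ℝ} (hC : ∀ᵐ t, ‖φ t‖ ≤ C) :
    Integrable fun t => (s t : ℂ) * φ t := by
  have := (hX.integrable.ofReal (𝕜 := ℂ)).bdd_mul hφ hC
  exact this.congr (ae_of_all _ fun t => mul_comm _ _)

lemma HasSpectralDensity.integrable_sym (hX : HasSpectralDensity P X s) (a b : ℝ →₀ ℝ) :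
    Integrable fun t => (s t : ℂ) * (sym a t * conj (sym b t)) := by
  obtain ⟨C, hC⟩ := exists_norm_sym_le a
  obtain ⟨D, hD⟩ := exists_norm_sym_le b
  refine hX.integrable_mul_of_bounded (C := C * D)
    ((continuous_sym a).mul (Complex.continuous_conj.comp (continuous_sym b))).aestronglyMeasurable
    (ae_of_all _ fun t => ?_)
  rw [norm_mul, RCLike.norm_conj]
  exact mul_le_mul (hC t) (hD t) (norm_nonneg _) ((norm_nonneg _).trans (hC t))

/-- The spectral isometry on finite linear combinations. -/
lemma HasSpectralDensity.integral_linearCombination_mul (hX : HasSpectralDensity P X s)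
    (a b : ℝ →₀ ℝ) :
    ((∫ ω, Finsupp.linearCombination ℝ X a ω * Finsupp.linearCombination ℝ X b ω ∂P : ℝ) : ℂ)
      = ∫ t, (s t : ℂ) * (sym a t * conj (sym b t)) := by
  have hi : ∀ a b : ℝ →₀ ℝ, Integrable (fun ω =>
      Finsupp.linearCombination ℝ X a ω * Finsupp.linearCombination ℝ X b ω) P := fun a b =>
    (hX.memLp_linearCombination a).integrable_mul (hX.memLp_linearCombination b)
  induction a using Finsupp.induction_linear with
  | zero => simp [sym]
  | add a a' ha ha' =>
    have e1 : ∀ ω, Finsupp.linearCombination ℝ X (a + a') ω * Finsupp.linearCombination ℝ X b ω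
        = Finsupp.linearCombination ℝ X a ω * Finsupp.linearCombination ℝ X b ω
          + Finsupp.linearCombination ℝ X a' ω * Finsupp.linearCombination ℝ X b ω := by
      intro ω; rw [map_add, Pi.add_apply, add_mul]
    have e2 : ∀ t, (s t : ℂ) * (sym (a + a') t * conj (sym b t))
        = (s t : ℂ) * (sym a t * conj (sym b t)) + (s t : ℂ) * (sym a' t * conj (sym b t)) := by
      intro t; rw [sym_add]; ring
    simp_rw [e1, e2]
    rw [integral_add (hi a b) (hi a' b), integral_add (hX.integrable_sym a b)
      (hX.integrable_sym a' b), ← ha, ← ha']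
    push_cast; rfl
  | single T c =>
    induction b using Finsupp.induction_linear with
    | zero => simp [sym]
    | add b b' hb hb' =>
      set a := Finsupp.single T c
      have e1 : ∀ ω, Finsupp.linearCombination ℝ X a ω * Finsupp.linearCombination ℝ X (b + b') ω
          = Finsupp.linearCombination ℝ X a ω * Finsupp.linearCombination ℝ X b ω
            + Finsupp.linearCombination ℝ X a ω * Finsupp.linearCombination ℝ X b' ω := by
        intro ω; rw [map_add, Pi.add_apply, mul_add]
      have e2 : ∀ t, (s t : ℂ) * (sym a t * conj (sym (b + b') t))
          = (s t : ℂ) * (sym a t * conj (sym b t)) + (s t : ℂ) * (sym a t * conj (sym b' t)) := by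
        intro t; rw [sym_add, map_add]; ring
      simp_rw [e1, e2]
      rw [integral_add (hi a b) (hi a b'), integral_add (hX.integrable_sym a b)
        (hX.integrable_sym a b'), ← hb, ← hb']
      push_cast; rfl
    | single T' c' =>
      have e1 : ∀ ω, Finsupp.linearCombination ℝ X (Finsupp.single T c) ω *
          Finsupp.linearCombination ℝ X (Finsupp.single T' c') ω
          = (c * c') * (X T ω * X T' ω) := by
        intro ω
        simp only [Finsupp.linearCombination_single, Pi.smul_apply, smul_eq_mul]
        ring
      have e2 : ∀ t, (s t : ℂ) * (sym (Finsupp.single T c) t * conj (sym (Finsupp.single T' c') t))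
          = (c * c' : ℂ) * ((s t : ℂ) * ex ((T - T') * t)) := by
        intro t
        rw [sym_single, sym_single, map_mul, conj_ex, Complex.conj_ofReal,
          show (T - T') * t = T * t + -(T' * t) by ring, ex_add]
        ring
      simp_rw [e1, e2]
      rw [integral_const_mul, integral_const_mul, ← hX.cov]
      push_cast; rfl

lemma HasSymbol.aestronglyMeasurable {Y : Ω → ℝ} {φ : ℝ → ℂ} (h : HasSymbol P X Y φ) :
    AEStronglyMeasurable φ := by
  obtain ⟨a, C, _, hlim, _⟩ := h.exists_approx
  exact aestronglyMeasurable_of_tendsto_ae atTop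
    (fun k => (continuous_sym (a k)).aestronglyMeasurable) hlim

lemma HasSpectralDensity.hasSymbol_linearCombination (hX : HasSpectralDensity P X s)
    (a : ℝ →₀ ℝ) : HasSymbol P X (Finsupp.linearCombination ℝ X a) (sym a) := by
  obtain ⟨C, hC⟩ := exists_norm_sym_le a
  exact ⟨hX.memLp_linearCombination a, fun _ => a, C, fun _ => hC,
    ae_of_all _ fun t => tendsto_const_nhds, by simp⟩

lemma HasSymbol.sub (hX : HasSpectralDensity P X s) {Y Z : Ω → ℝ} {φ ψ : ℝ → ℂ}
    (h : HasSymbol P X Y φ) (h' : HasSymbol P X Z ψ) : HasSymbol P X (Y - Z) (φ - ψ) := by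
  obtain ⟨a, C, hC, hlim, hL⟩ := h.exists_approx
  obtain ⟨b, D, hD, hlim', hL'⟩ := h'.exists_approx
  refine ⟨h.memLp.sub h'.memLp, fun k => a k - b k, C + D, fun k t => ?_, ?_, ?_⟩
  · rw [sym_sub]
    exact (norm_sub_le _ _).trans (add_le_add (hC k t) (hD k t))
  · filter_upwards [hlim, hlim'] with t h1 h2
    simp_rw [sym_sub]
    exact h1.sub h2
  · refine tendsto_of_tendsto_of_tendsto_of_le_of_le tendsto_const_nhds
      (by simpa using hL.add hL') (fun _ => zero_le) fun k => ?_
    have e : Finsupp.linearCombination ℝ X (a k - b k) - (Y - Z)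
        = (Finsupp.linearCombination ℝ X (a k) - Y) -
          (Finsupp.linearCombination ℝ X (b k) - Z) := by
      rw [map_sub]; abel
    simp only [e]
    exact eLpNorm_sub_le
      ((hX.memLp_linearCombination _).sub h.memLp).aestronglyMeasurable
      ((hX.memLp_linearCombination _).sub h'.memLp).aestronglyMeasurable (by norm_num)

/-- The spectral isometry for mean-square limits. -/
lemma HasSymbol.integral_mul (hX : HasSpectralDensity P X s) {Y Z : Ω → ℝ} {φ ψ : ℝ → ℂ}
    (h : HasSymbol P X Y φ) (h' : HasSymbol P X Z ψ) :
    ((∫ ω, Y ω * Z ω ∂P : ℝ) : ℂ) = ∫ t, (s t : ℂ) * (φ t * conj (ψ t)) := by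
  obtain ⟨a, C, hC, hlim, hL⟩ := h.exists_approx
  obtain ⟨b, D, hD, hlim', hL'⟩ := h'.exists_approx
  have h1 := tendsto_integral_mul_of_tendsto_eLpNorm (fun k => hX.memLp_linearCombination (a k))
    (fun k => hX.memLp_linearCombination (b k)) h.memLp h'.memLp hL hL'
  have h2 := (Complex.continuous_ofReal.tendsto _).comp h1
  refine tendsto_nhds_unique h2 ?_
  simp only [Function.comp_def, hX.integral_linearCombination_mul]
  refine tendsto_integral_of_dominated_convergence (fun t => |s t| * (C * D))
    (fun k => (hX.integrable_sym _ _).aestronglyMeasurable) (hX.integrable.abs.mul_const _)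
    (fun k => ae_of_all _ fun t => ?_) ?_
  · rw [norm_mul, norm_mul, RCLike.norm_conj, Complex.norm_real, Real.norm_eq_abs]
    exact mul_le_mul_of_nonneg_left (mul_le_mul (hC k t) (hD k t) (norm_nonneg _)
      ((norm_nonneg _).trans (hC k t))) (abs_nonneg _)
  · filter_upwards [hlim, hlim'] with t h1 h2
    exact (h1.mul ((Complex.continuous_conj.tendsto _).comp h2)).const_mul _

lemma HasSymbol.integral_sq (hX : HasSpectralDensity P X s) {Y : Ω → ℝ} {φ : ℝ → ℂ}
    (h : HasSymbol P X Y φ) : ∫ ω, Y ω ^ 2 ∂P = ∫ t, s t * ‖φ t‖ ^ 2 := by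
  have h1 := h.integral_mul hX h
  have e : ∀ t, (s t : ℂ) * (φ t * conj (φ t)) = ((s t * ‖φ t‖ ^ 2 : ℝ) : ℂ) := by
    intro t; rw [Complex.mul_conj, Complex.normSq_eq_norm_sq]; push_cast; rfl
  simp_rw [e] at h1
  rw [integral_complex_ofReal] at h1
  simp_rw [sq (Y _)]
  exact_mod_cast h1

/-- Bounded almost everywhere convergence of the symbols forces mean-square convergence of the
linear combinations, since the spectral density is integrable. -/
lemma HasSpectralDensity.exists_hasSymbol (hX : HasSpectralDensity P X s)
    {a : ℕ → ℝ →₀ ℝ} {C : ℝ} {φ : ℝ → ℂ} (hC : ∀ k t, ‖sym (a k) t‖ ≤ C)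
    (hlim : ∀ᵐ t, Tendsto (fun k => sym (a k) t) atTop (𝓝 (φ t))) :
    ∃ Y, MemLp Y 2 P ∧
      Tendsto (fun k => eLpNorm (Finsupp.linearCombination ℝ X (a k) - Y) 2 P) atTop (𝓝 0) := by
  set u : ℕ → Lp ℝ 2 P := fun k => (hX.memLp_linearCombination (a k)).toLp _ with hu
  have hdist : ∀ p : ℕ × ℕ, dist (u p.1) (u p.2) ^ 2
      = ∫ t, s t * ‖sym (a p.1) t - sym (a p.2) t‖ ^ 2 := by
    intro p
    rw [dist_eq_norm, hu, ← MemLp.toLp_sub, norm_toLp_sq_eq_integral]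
    have := (hX.hasSymbol_linearCombination (a p.1 - a p.2)).integral_sq hX
    rw [map_sub] at this
    rw [this]
    simp_rw [sym_sub]
  have hint : Tendsto (fun p : ℕ × ℕ => ∫ t, s t * ‖sym (a p.1) t - sym (a p.2) t‖ ^ 2) atTop
      (𝓝 (∫ _ : ℝ, (0 : ℝ))) := by
    refine tendsto_integral_filter_of_dominated_convergence (fun t => |s t| * (C + C) ^ 2)
      (Eventually.of_forall fun p => ?_) (Eventually.of_forall fun p => ae_of_all _ fun t => ?_)
      (hX.integrable.abs.mul_const _) ?_
    · exact hX.integrable.aestronglyMeasurable.mul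
        (((continuous_sym _).sub (continuous_sym _)).norm.pow 2).aestronglyMeasurable
    · rw [norm_mul, Real.norm_eq_abs, norm_pow, norm_norm]
      refine mul_le_mul_of_nonneg_left (pow_le_pow_left₀ (norm_nonneg _) ?_ 2) (abs_nonneg _)
      exact (norm_sub_le _ _).trans (add_le_add (hC _ t) (hC _ t))
    · filter_upwards [hlim] with t ht
      have h1 : Tendsto (fun p : ℕ × ℕ => sym (a p.1) t) atTop (𝓝 (φ t)) :=
        ht.comp (by rw [← prod_atTop_atTop_eq]; exact tendsto_fst)
      have h2 : Tendsto (fun p : ℕ × ℕ => sym (a p.2) t) atTop (𝓝 (φ t)) :=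
        ht.comp (by rw [← prod_atTop_atTop_eq]; exact tendsto_snd)
      simpa using ((h1.sub h2).norm.pow 2).const_mul (s t)
  have hcauchy : CauchySeq u := by
    rw [cauchySeq_iff_tendsto_dist_atTop_0]
    simp_rw [← hdist] at hint
    rw [integral_zero] at hint
    have := hint.sqrt
    simpa [Real.sqrt_sq] using this
  obtain ⟨Y, hY⟩ := cauchySeq_tendsto_of_complete hcauchy
  refine ⟨Y, Lp.memLp Y, ?_⟩
  rw [← Lp.tendsto_Lp_iff_tendsto_eLpNorm'' _ (fun k => hX.memLp_linearCombination (a k)) _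
    (Lp.memLp Y), Lp.toLp_coeFn]
  exact hY

end Spectral

/-! ### The ideally delayed samples and their observed versions -/

/-- The symbol `e^{2πi(n+τ)t} H(t)` of the delayed sample at time `n`, where the frequency response
`H` of the delay is the periodic extension of `e^{-2πiτt}`, `|t| < 1/2`. -/
def delaySym (τ : ℝ) (n : ℤ) (t : ℝ) : ℂ := ex ((n + τ) * t) * ex (-(τ * (t - round t)))

/-- On the subband of index `round t` the delay leaves only the phase `e^{2πiτ round(t)}`. -/
lemma delaySym_eq (τ : ℝ) (n : ℤ) (t : ℝ) : delaySym τ n t = ex (n * t) * ex (τ * round t) := by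
  rw [delaySym, ← ex_add, ← ex_add]; ring_nf

lemma norm_delaySym (τ : ℝ) (n : ℤ) (t : ℝ) : ‖delaySym τ n t‖ = 1 := by
  simp [delaySym]

lemma delaySym_mul_conj (τ σ : ℝ) (n m : ℤ) (t : ℝ) :
    delaySym τ n t * conj (delaySym σ m t) = ex ((n - m) * t) * ex ((τ - σ) * round t) := by
  rw [delaySym_eq, delaySym_eq, map_mul, conj_ex, conj_ex, ← ex_add, ← ex_add, ← ex_add, ← ex_add]
  ring_nf

/-- Coefficients of the symmetric partial sums of the convolution that defines the delayed sample
at time `n`, the undelayed samples being `X(k + τ)`. -/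
def delayCoeff (τ : ℝ) (n : ℤ) (M : ℕ) : ℝ →₀ ℝ :=
  ∑ m ∈ Finset.Icc (-(M : ℤ)) M, Finsupp.single ((n - m : ℤ) + τ) (hk τ m)

/-- Coefficients of the delayed sample at time `n` that is computed from the samples
`X(k + τ)`, `0 ≤ k < N`. -/
def obsCoeff (τ : ℝ) (N n : ℕ) : ℝ →₀ ℝ :=
  ∑ k ∈ Finset.range N, Finsupp.single (k + τ) (hk τ ((n : ℤ) - k))

lemma sum_Icc_neg_eq {E : Type*} [AddCommMonoid E] (f : ℤ → E) (M : ℕ) :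
    ∑ m ∈ Finset.Icc (-(M : ℤ)) M, f m
      = ∑ k ∈ Finset.range (M + 1), f k + ∑ k ∈ Finset.range M, f (-((k : ℤ) + 1)) := by
  induction M with
  | zero => simp
  | succ M ih =>
    have : Finset.Icc (-((M + 1 : ℕ) : ℤ)) ((M + 1 : ℕ) : ℤ)
        = insert ((M + 1 : ℕ) : ℤ) (insert (-((M : ℤ) + 1)) (Finset.Icc (-(M : ℤ)) M)) := by
      ext m; simp only [Finset.mem_Icc, Finset.mem_insert]; omega
    rw [this, Finset.sum_insert, Finset.sum_insert, ih, Finset.sum_range_succ _ (M + 1),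
      Finset.sum_range_succ (fun k : ℕ => f (-((k : ℤ) + 1))) M]
    · abel
    · simp
    · simp only [Finset.mem_insert, Finset.mem_Icc]; omega

lemma sym_delayCoeff (τ : ℝ) (n : ℤ) (M : ℕ) (t : ℝ) :
    sym (delayCoeff τ n M) t = ex ((n + τ) * t) * dSum τ M (M + 1) t := by
  have h := sum_Icc_neg_eq (fun m : ℤ => (hk τ m : ℂ) * ex (-(m * t))) M
  rw [dSum]
  push_cast at h ⊢
  rw [← h, delayCoeff, sym_sum, Finset.mul_sum]
  refine Finset.sum_congr rfl fun m _ => ?_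
  rw [sym_single, mul_left_comm, ← ex_add]
  push_cast
  ring_nf

lemma sym_obsCoeff (τ : ℝ) {N n : ℕ} (hn : n < N) (t : ℝ) :
    sym (obsCoeff τ N n) t = ex ((n + τ) * t) * dSum τ (N - 1 - n) (n + 1) t := by
  rw [← sum_hk_mul_ex τ hn, obsCoeff, sym_sum]
  simp_rw [sym_single]

/-- The sum over the observation window of the squared symbols of the observed delayed samples is
at most the length of the window, at every frequency. -/
lemma sum_norm_sq_sym_obsCoeff_le (τ : ℝ) (N : ℕ) (t : ℝ) :
    ∑ n ∈ Finset.range N, ‖sym (obsCoeff τ N n) t‖ ^ 2 ≤ N := by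
  have h := sum_norm_sq_conv_hk_le τ N (fun k => ex ((k + τ) * t))
  simp only [norm_ex, one_pow, Finset.sum_const, Finset.card_range, nsmul_eq_mul, mul_one] at h
  refine le_trans (le_of_eq ?_) h
  refine Finset.sum_congr rfl fun n _ => ?_
  rw [obsCoeff, sym_sum]
  simp_rw [sym_single, mul_comm]

section Delay

variable {Ω : Type*} [MeasurableSpace Ω] {P : Measure Ω} {X : ℝ → Ω → ℝ} {s : ℝ → ℝ} {τ : ℝ}

lemma ae_tendsto_sym_delayCoeff (h0 : 0 ≤ τ) (h1 : τ < 1) (n : ℤ) :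
    ∀ᵐ t, Tendsto (fun M => sym (delayCoeff τ n M) t) atTop (𝓝 (delaySym τ n t)) := by
  filter_upwards [ae_abs_sub_round_lt] with t ht
  simp_rw [sym_delayCoeff]
  refine Tendsto.const_mul _ ?_
  obtain ⟨ε, hε, hb⟩ := exists_norm_dSum_sub_le h0 h1 ht
  rw [tendsto_iff_norm_sub_tendsto_zero]
  have h2 : Tendsto (fun M => ε M + ε (M + 1)) atTop (𝓝 0) := by
    simpa using hε.add ((tendsto_add_atTop_iff_nat 1).2 hε)
  exact squeeze_zero (fun _ => norm_nonneg _) (fun M => hb M (M + 1)) h2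

lemma exists_norm_sym_delayCoeff_le (h0 : 0 ≤ τ) (h1 : τ < 1) (n : ℤ) :
    ∃ C : ℝ, ∀ M t, ‖sym (delayCoeff τ n M) t‖ ≤ C := by
  obtain ⟨C, hC⟩ := exists_norm_dSum_symm_le h0 h1
  exact ⟨C, fun M t => by rw [sym_delayCoeff, norm_mul, norm_ex, one_mul]; exact hC M t⟩

/-- The delayed samples exist as mean-square limits. -/
lemma HasSpectralDensity.exists_delayed (hX : HasSpectralDensity P X s) (h0 : 0 ≤ τ) (h1 : τ < 1)
    (n : ℤ) : ∃ Y, MemLp Y 2 P ∧ Tendsto (fun M =>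
      eLpNorm (Finsupp.linearCombination ℝ X (delayCoeff τ n M) - Y) 2 P) atTop (𝓝 0) := by
  obtain ⟨C, hC⟩ := exists_norm_sym_delayCoeff_le h0 h1 n
  exact hX.exists_hasSymbol hC (ae_tendsto_sym_delayCoeff h0 h1 n)

lemma hasSymbol_delaySym (h0 : 0 ≤ τ) (h1 : τ < 1) {n : ℤ} {Y : Ω → ℝ} (hY : MemLp Y 2 P)
    (h : Tendsto (fun M => eLpNorm (Finsupp.linearCombination ℝ X (delayCoeff τ n M) - Y) 2 P)
      atTop (𝓝 0)) : HasSymbol P X Y (delaySym τ n) := by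
  obtain ⟨C, hC⟩ := exists_norm_sym_delayCoeff_le h0 h1 n
  exact ⟨hY, _, C, hC, ae_tendsto_sym_delayCoeff h0 h1 n, h⟩

/-- The edge effects of the observation window, `E |z^N(n) - z(n)|²`, vanish on time average. -/
lemma HasSpectralDensity.tendsto_mean_edge (hX : HasSpectralDensity P X s) (h0 : 0 ≤ τ)
    (h1 : τ < 1) {z : ℤ → Ω → ℝ} (hz : ∀ n, HasSymbol P X (z n) (delaySym τ n)) :
    Tendsto (fun N : ℕ => (N : ℝ)⁻¹ * ∑ n ∈ Finset.range N,
      ∫ ω, (Finsupp.linearCombination ℝ X (obsCoeff τ N n) ω - z n ω) ^ 2 ∂P) atTop (𝓝 0) := by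
  have hsymb : ∀ N n : ℕ, HasSymbol P X (Finsupp.linearCombination ℝ X (obsCoeff τ N n) - z n)
      (sym (obsCoeff τ N n) - delaySym τ n) := fun N n =>
    (hX.hasSymbol_linearCombination _).sub hX (hz n)
  have hint : ∀ N n : ℕ, Integrable fun t =>
      s t * ‖sym (obsCoeff τ N n) t - delaySym τ n t‖ ^ 2 := by
    intro N n
    obtain ⟨C, hC⟩ := exists_norm_sym_le (obsCoeff τ N n)
    have := hX.integrable.bdd_mul (f := fun t => ‖sym (obsCoeff τ N n) t - delaySym τ n t‖ ^ 2)
      (c := (C + 1) ^ 2) ((hsymb N n).aestronglyMeasurable.norm.pow 2) (ae_of_all _ fun t => ?_)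
    · exact this.congr (ae_of_all _ fun t => mul_comm _ _)
    · rw [norm_pow, norm_norm]
      refine pow_le_pow_left₀ (norm_nonneg _) ?_ 2
      exact (norm_sub_le _ _).trans (add_le_add (hC t) (norm_delaySym _ _ _).le)
  have e : ∀ N : ℕ, (N : ℝ)⁻¹ * ∑ n ∈ Finset.range N,
      ∫ ω, (Finsupp.linearCombination ℝ X (obsCoeff τ N n) ω - z n ω) ^ 2 ∂P
      = ∫ t, s t * ((N : ℝ)⁻¹ * ∑ n ∈ Finset.range N,
        ‖sym (obsCoeff τ N n) t - delaySym τ n t‖ ^ 2) := by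
    intro N
    have e1 : ∀ t, s t * ((N : ℝ)⁻¹ * ∑ n ∈ Finset.range N,
        ‖sym (obsCoeff τ N n) t - delaySym τ n t‖ ^ 2) = (N : ℝ)⁻¹ * ∑ n ∈ Finset.range N,
        s t * ‖sym (obsCoeff τ N n) t - delaySym τ n t‖ ^ 2 := by
      intro t; rw [mul_left_comm, Finset.mul_sum]
    simp_rw [e1]
    rw [integral_const_mul, integral_finsetSum _ fun n _ => hint N n]
    congr 1
    refine Finset.sum_congr rfl fun n _ => ?_
    have := (hsymb N n).integral_sq hX
    simpa only [Pi.sub_apply] using this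
  simp_rw [e]
  rw [← integral_zero ℝ ℝ (μ := volume)]
  refine tendsto_integral_of_dominated_convergence (fun t => |s t| * 4) (fun N => ?_)
    (hX.integrable.abs.mul_const _) (fun N => ae_of_all _ fun t => ?_) ?_
  · refine hX.integrable.aestronglyMeasurable.mul (AEStronglyMeasurable.const_mul ?_ _)
    exact Finset.aestronglyMeasurable_fun_sum _ fun n _ =>
      (hsymb N n).aestronglyMeasurable.norm.pow 2
  · rw [norm_mul, Real.norm_eq_abs, Real.norm_of_nonneg (by positivity)]
    refine mul_le_mul_of_nonneg_left ?_ (abs_nonneg _)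
    have h2 : ∑ n ∈ Finset.range N, ‖sym (obsCoeff τ N n) t - delaySym τ n t‖ ^ 2
        ≤ ∑ n ∈ Finset.range N, (2 * ‖sym (obsCoeff τ N n) t‖ ^ 2 + 2) := by
      refine Finset.sum_le_sum fun n _ => ?_
      have h3 := norm_sub_le (sym (obsCoeff τ N n) t) (delaySym τ n t)
      rw [norm_delaySym] at h3
      have h4 := pow_le_pow_left₀ (norm_nonneg _) h3 2
      nlinarith [sq_nonneg (‖sym (obsCoeff τ N n) t‖ - 1)]
    rw [Finset.sum_add_distrib, ← Finset.mul_sum, Finset.sum_const, Finset.card_range,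
      nsmul_eq_mul] at h2
    have h5 := sum_norm_sq_sym_obsCoeff_le τ N t
    rcases Nat.eq_zero_or_pos N with rfl | hN
    · simp
    · have hN' : (0 : ℝ) < N := by exact_mod_cast hN
      rw [inv_mul_le_iff₀ hN']
      linarith
  · filter_upwards [ae_abs_sub_round_lt] with t ht
    have h2 := (tendsto_mean_norm_sq_dSum_sub h0 h1 ht).const_mul (s t)
    rw [mul_zero] at h2
    refine h2.congr fun N => ?_
    congr 2
    refine Finset.sum_congr rfl fun n hn => ?_
    rw [sym_obsCoeff τ (Finset.mem_range.1 hn), delaySym, Int.cast_natCast, ← mul_sub, norm_mul,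
      norm_ex, one_mul]

/-- The cross-correlation of delayed samples in terms of the spectral density. -/
lemma HasSpectralDensity.integral_delayed_mul (hX : HasSpectralDensity P X s) {σ : ℝ} {n m : ℤ}
    {Y Z : Ω → ℝ} (hY : HasSymbol P X Y (delaySym τ n)) (hZ : HasSymbol P X Z (delaySym σ m)) :
    ((∫ ω, Y ω * Z ω ∂P : ℝ) : ℂ)
      = ∫ t, (s t : ℂ) * (ex ((n - m : ℤ) * t) * ex ((τ - σ) * round t)) := by
  rw [hY.integral_mul hX hZ]
  simp_rw [delaySym_mul_conj]
  push_cast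
  rfl

/-- By the Riemann-Lebesgue lemma the cross-correlations vanish at infinity. -/
lemma tendsto_corr_cofinite (s : ℝ → ℝ) (α : ℝ) :
    Tendsto (fun k : ℤ => ∫ t, (s t : ℂ) * (ex (k * t) * ex (α * round t)))
      cofinite (𝓝 0) := by
  have h := Real.tendsto_integral_exp_smul_cocompact fun t => (s t : ℂ) * ex (α * round t)
  have h2 : Tendsto (fun k : ℤ => ((-k : ℤ) : ℝ)) cofinite (cocompact ℝ) :=
    Int.tendsto_coe_cofinite.comp neg_injective.tendsto_cofinite
  refine (h.comp h2).congr fun k => ?_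
  refine integral_congr_ae (ae_of_all _ fun t => ?_)
  simp only [Circle.smul_def, smul_eq_mul]
  rw [show -(t * ((-k : ℤ) : ℝ)) = k * t by push_cast; ring]
  change ex (k * t) * _ = _
  ring

end Delay

/-! ### Multi-coset samples in normalized units -/

/-- The spectral density as a function of the frequency in cycles per sampling period `L / W` of a
channel; the subbands become unit intervals. -/
def normDensity (S : ℝ → ℝ) (W : ℝ) (L : ℕ) (t : ℝ) : ℝ :=
  W / L * S (2 * Real.pi * (W / L) * t)

lemma mcSample_eq {Ω : Type*} {x : ℝ → Ω → ℝ} {W : ℝ} {q L : ℕ} {c : Fin q → ℕ} (hL : 0 < L)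
    (i : Fin q) (n : ℤ) :
    mcSample x W L c i n = x ((n + (c i : ℝ) / L) * L / W) := by
  have hL' : (L : ℝ) ≠ 0 := by exact_mod_cast hL.ne'
  funext ω
  rw [mcSample]
  congr 2
  field_simp

lemma linearCombination_delayCoeff {Ω : Type*} {x : ℝ → Ω → ℝ} {W : ℝ} {q L : ℕ} {c : Fin q → ℕ}
    (hL : 0 < L) (i : Fin q) (n : ℤ) (M : ℕ) (ω : Ω) :
    Finsupp.linearCombination ℝ (fun T => x (T * L / W)) (delayCoeff ((c i : ℝ) / L) n M) ω
      = ∑ m ∈ Finset.Icc (-(M : ℤ)) (M : ℤ),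
        delayFilter L c i m * mcSample x W L c i (n - m) ω := by
  rw [delayCoeff, map_sum, Finset.sum_apply]
  refine Finset.sum_congr rfl fun m _ => ?_
  rw [Finsupp.linearCombination_single, mcSample_eq hL]
  rfl

lemma linearCombination_obsCoeff {Ω : Type*} {x : ℝ → Ω → ℝ} {W : ℝ} {q L : ℕ} {c : Fin q → ℕ}
    (hL : 0 < L) (i : Fin q) (N n : ℕ) (ω : Ω) :
    Finsupp.linearCombination ℝ (fun T => x (T * L / W)) (obsCoeff ((c i : ℝ) / L) N n) ω
      = delayedObs (delayFilter L c i) (mcSample x W L c i) N n ω := by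
  rw [delayedObs_eq_sum, obsCoeff, map_sum, Finset.sum_apply]
  refine Finset.sum_congr rfl fun m _ => ?_
  rw [Finsupp.linearCombination_single, mcSample_eq hL]
  rfl

section Bridge

variable {Ω : Type*} [MeasurableSpace Ω] {P : Measure Ω} {x : ℝ → Ω → ℝ} {r S : ℝ → ℝ} {W : ℝ}
  {q L : ℕ} {c : Fin q → ℕ}

lemma hasSpectralDensity_normDensity (hW : 0 < W) (hL : 0 < L) (hx : IsZeroMeanWSS P x r)
    (hS : IsPSD S r) :
    HasSpectralDensity P (fun T => x (T * L / W)) (normDensity S W L) := by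
  have hL' : (0 : ℝ) < L := by exact_mod_cast hL
  have hpi := Real.pi_pos
  have hκ : 0 < 2 * Real.pi * (W / L) := by positivity
  refine ⟨fun T => hx.memLp _, ?_, fun T T' => ?_⟩
  · exact (hS.integrable.comp_mul_left' hκ.ne').const_mul _
  · rw [hx.autocorr, hS.inversion]
    have h := Measure.integral_comp_mul_left (fun w : ℝ => (S w : ℂ) * Complex.exp (Complex.I * w *
      ((T * L / W - T' * L / W : ℝ) : ℂ))) (2 * Real.pi * (W / L))
    rw [abs_of_pos (by positivity), Complex.real_smul] at h
    have e : ∀ t : ℝ, (normDensity S W L t : ℂ) * ex ((T - T') * t)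
        = ((W / L : ℝ) : ℂ) * ((S (2 * Real.pi * (W / L) * t) : ℂ) * Complex.exp (Complex.I *
          ((2 * Real.pi * (W / L) * t : ℝ) : ℂ) * ((T * L / W - T' * L / W : ℝ) : ℂ))) := by
      intro t
      rw [normDensity, ex_eq_exp, Complex.ofReal_mul, mul_assoc]
      congr 3
      have : (W : ℂ) ≠ 0 := by exact_mod_cast hW.ne'
      have : (L : ℂ) ≠ 0 := by exact_mod_cast hL'.ne'
      push_cast
      field_simp
    simp_rw [e]
    rw [integral_const_mul, h, ← mul_assoc]
    congr 1
    have : (W : ℂ) ≠ 0 := by exact_mod_cast hW.ne'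
    have : (L : ℂ) ≠ 0 := by exact_mod_cast hL'.ne'
    have : (Real.pi : ℂ) ≠ 0 := by exact_mod_cast hpi.ne'
    push_cast
    field_simp

lemma delay_mem (hc : ∀ i, c i < L) (i : Fin q) : 0 ≤ (c i : ℝ) / L ∧ (c i : ℝ) / L < 1 := by
  have hL' : (0 : ℝ) < L := by exact_mod_cast (Nat.zero_le _).trans_lt (hc i)
  refine ⟨by positivity, ?_⟩
  rw [div_lt_one hL']
  exact_mod_cast hc i

lemma exists_isFilterOutput (hW : 0 < W) (hL : 0 < L) (hx : IsZeroMeanWSS P x r)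
    (hS : IsPSD S r) (hc : ∀ i, c i < L) :
    ∃ z : Fin q → ℤ → Ω → ℝ, IsFilterOutput P (delayFilter L c) (mcSample x W L c) z := by
  have hX := hasSpectralDensity_normDensity hW hL hx hS
  choose z hz1 hz2 using fun (i : Fin q) (n : ℤ) =>
    hX.exists_delayed (delay_mem hc i).1 (delay_mem hc i).2 n
  refine ⟨z, fun i n => ⟨hz1 i n, (hz2 i n).congr fun M => ?_⟩⟩
  congr 1
  funext ω
  rw [Pi.sub_apply, linearCombination_delayCoeff hL]

lemma IsFilterOutput.hasSymbol (hL : 0 < L) (hc : ∀ i, c i < L) {z : Fin q → ℤ → Ω → ℝ}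
    (hz : IsFilterOutput P (delayFilter L c) (mcSample x W L c) z) (i : Fin q) (n : ℤ) :
    HasSymbol P (fun T => x (T * L / W)) (z i n) (delaySym ((c i : ℝ) / L) n) := by
  refine hasSymbol_delaySym (delay_mem hc i).1 (delay_mem hc i).2 (hz i n).1
    ((hz i n).2.congr fun M => ?_)
  congr 1
  funext ω
  rw [Pi.sub_apply, linearCombination_delayCoeff hL]

/-- The delayed samples have cross-correlations that depend on the lag only, and have the spectral
density of the process, multiplied by a phase that is constant on each subband. -/
lemma IsFilterOutput.integral_mul (hW : 0 < W) (hL : 0 < L) (hx : IsZeroMeanWSS P x r)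
    (hS : IsPSD S r) (hc : ∀ i, c i < L) {z : Fin q → ℤ → Ω → ℝ}
    (hz : IsFilterOutput P (delayFilter L c) (mcSample x W L c) z) (a b : Fin q) (n m : ℤ) :
    ((∫ ω, z a n ω * z b m ω ∂P : ℝ) : ℂ) = ∫ t, (normDensity S W L t : ℂ) *
      (ex ((n - m : ℤ) * t) * ex (((c a : ℝ) / L - (c b : ℝ) / L) * round t)) :=
  (hasSpectralDensity_normDensity hW hL hx hS).integral_delayed_mul (hz.hasSymbol hL hc a n)
    (hz.hasSymbol hL hc b m)

lemma bandPower_eq (hW : 0 < W) (hL : 0 < L) (m : ℤ) :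
    bandPower S W L m = ∫ t in (-m - 1 / 2 : ℝ)..(-m + 1 / 2), normDensity S W L t := by
  have hL' : (0 : ℝ) < L := by exact_mod_cast hL
  have hpi := Real.pi_pos
  have hκ : 2 * Real.pi * (W / L) ≠ 0 := by positivity
  have h1 := intervalIntegral.integral_comp_sub_right (a := -(1 / 2)) (b := 1 / 2)
    (fun t => normDensity S W L t) (m : ℝ)
  rw [show (-(m : ℝ) - 1 / 2) = -(1 / 2) - m by ring, show (-(m : ℝ) + 1 / 2) = 1 / 2 - m by ring,
    ← h1]
  have h2 := intervalIntegral.integral_comp_mul_left (a := -(1 / 2)) (b := 1 / 2)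
    (fun w => S (w - 2 * Real.pi * (W / L) * m)) hκ
  rw [show 2 * Real.pi * (W / L) * (-(1 / 2)) = -(Real.pi * W / L) by ring,
    show 2 * Real.pi * (W / L) * (1 / 2) = Real.pi * W / L by ring, smul_eq_mul] at h2
  simp only [normDensity, mul_sub]
  rw [intervalIntegral.integral_const_mul, h2, bandPower, ← mul_assoc]
  congr 1
  field_simp

/-- The phase in the cross-correlation at lag zero is constant on each subband; the outermost two
half-subbands share the last column of `Ψ` because `L` is even. -/
lemma integral_normDensity_mul_ex (hW : 0 < W) (hL : 0 < L) (hLeven : Even L)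
    (hS : Integrable S) (hband : IsBandLimited S W) (D : ℤ) :
    ∫ t, (normDensity S W L t : ℂ) * ex ((D / L : ℝ) * round t)
      = ∑ l : Fin L, ex (-((D / L : ℝ) * bandIndex L l)) * (powerVec S W L l : ℂ) := by
  have hL' : (0 : ℝ) < L := by exact_mod_cast hL
  have hpi := Real.pi_pos
  have hκ : 0 < 2 * Real.pi * (W / L) := by positivity
  obtain ⟨H, hH⟩ := hLeven
  have hH2 : L / 2 = H := by omega
  have hHL : (L : ℝ) = 2 * H := by rw [hH]; push_cast; ring
  set s := normDensity S W L with hs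
  set α : ℝ := D / L with hα
  have hsint : Integrable s := (hS.comp_mul_left' hκ.ne').const_mul _
  have hsupp : ∀ t : ℝ, (H : ℝ) < |t| → s t = 0 := by
    intro t ht
    rw [hs, normDensity, hband, mul_zero]
    rw [abs_mul, abs_of_pos hκ]
    calc Real.pi * W = 2 * Real.pi * (W / L) * H := by
          rw [hHL]
          have : (H : ℝ) ≠ 0 := by intro h; rw [h] at hHL; linarith
          field_simp
      _ < _ := mul_lt_mul_of_pos_left ht hκ
  set g : ℝ → ℂ := fun t => (s t : ℂ) * ex (α * round t) with hg
  have hround : Measurable fun t : ℝ => ((round t : ℤ) : ℝ) := by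
    have : (fun t : ℝ => ((round t : ℤ) : ℝ)) = fun t : ℝ => ((⌊t + 1 / 2⌋ : ℤ) : ℝ) := by
      funext t; rw [round_eq]
    rw [this]
    exact (measurable_from_top (f := fun n : ℤ => (n : ℝ))).comp
      (Int.measurable_floor.comp (measurable_id.add_const _))
  have hgint : Integrable g := by
    have h2 : AEStronglyMeasurable (fun t : ℝ => ex (α * round t)) :=
      (continuous_ex.measurable.comp (hround.const_mul α)).aestronglyMeasurable
    have := (hsint.ofReal (𝕜 := ℂ)).bdd_mul h2 (ae_of_all _ fun t => (norm_ex _).le)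
    exact this.congr (ae_of_all _ fun t => mul_comm _ _)
  set a : ℕ → ℝ := fun k => (k : ℝ) - H - 1 / 2 with ha
  have hsum : ∫ t, g t = ∑ k ∈ Finset.range (L + 1), ∫ t in (a k)..(a (k + 1)), g t := by
    rw [intervalIntegral.sum_integral_adjacent_intervals fun k _ => hgint.intervalIntegrable,
      intervalIntegral.integral_of_le (by simp only [ha]; push_cast; linarith)]
    refine (setIntegral_eq_integral_of_forall_compl_eq_zero fun t ht => ?_).symm
    simp only [hg]
    rw [hsupp, Complex.ofReal_zero, zero_mul]
    by_contra h
    have h3 := abs_le.1 (not_lt.1 h)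
    exact ht ⟨by simp only [ha]; push_cast; linarith [h3.1],
      by simp only [ha]; push_cast; linarith [h3.2]⟩
  have hpiece : ∀ k : ℕ, ∫ t in (a k)..(a (k + 1)), g t
      = ex (α * (k - H : ℤ)) * (bandPower S W L (-(k - H : ℤ)) : ℂ) := by
    intro k
    rw [bandPower_eq hW hL, ← intervalIntegral.integral_ofReal,
      ← intervalIntegral.integral_const_mul]
    have e1 : a k = -((-(k - H : ℤ) : ℤ) : ℝ) - 1 / 2 := by simp only [ha]; push_cast; ring
    have e2 : a (k + 1) = -((-(k - H : ℤ) : ℤ) : ℝ) + 1 / 2 := by simp only [ha]; push_cast; ring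
    rw [← e1, ← e2]
    refine intervalIntegral.integral_congr_ae ?_
    filter_upwards [ae_abs_sub_round_lt] with t ht hmem
    rw [Set.uIoc_of_le (by simp only [ha]; push_cast; linarith)] at hmem
    have hr : round t = (k - H : ℤ) := by
      have h2 := abs_lt.1 ht
      have h3 := hmem.1
      have h4 := hmem.2
      simp only [ha] at h3 h4
      push_cast at h4
      have u1 : ((round t : ℤ) : ℝ) < ((k - H + 1 : ℤ) : ℝ) := by push_cast; linarith [h2.1]
      have u2 : ((k - H - 1 : ℤ) : ℝ) < ((round t : ℤ) : ℝ) := by push_cast; linarith [h2.2]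
      have u3 := Int.cast_lt.1 u1
      have u4 := Int.cast_lt.1 u2
      omega
    simp only [hg]
    rw [hr, mul_comm]
  rw [hsum, ← Finset.sum_range_reflect, Finset.sum_range_succ']
  have hterm : ∀ k < L, ∫ t in (a (L + 1 - 1 - (k + 1)))..(a (L + 1 - 1 - (k + 1) + 1)), g t
      = ex (-(α * (-(H : ℤ) + 1 + k : ℤ))) * (bandPower S W L (-(H : ℤ) + 1 + k) : ℂ) := by
    intro k hk
    rw [hpiece]
    have : ((L + 1 - 1 - (k + 1) : ℕ) : ℤ) - H = -(-(H : ℤ) + 1 + k) := by omega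
    rw [this, neg_neg]
    push_cast
    ring_nf
  rw [Finset.sum_congr rfl fun k hk => hterm k (Finset.mem_range.1 hk), hpiece,
    ← Fin.sum_univ_eq_sum_range
      (fun k => ex (-(α * (-(H : ℤ) + 1 + k : ℤ))) * (bandPower S W L (-(H : ℤ) + 1 + k) : ℂ))]
  have hlast : ((L + 1 - 1 - 0 : ℕ) : ℤ) - H = H := by omega
  rw [hlast]
  have hpow : ∀ l : Fin L, (powerVec S W L l : ℂ) = (bandPower S W L (-(H : ℤ) + 1 + (l : ℕ)) : ℂ) +
      if l = ⟨L - 1, by omega⟩ then (bandPower S W L (-(H : ℤ)) : ℂ) else 0 := by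
    intro l
    have hl := l.2
    rw [powerVec, bandIndex, hH2]
    by_cases h : l = ⟨L - 1, by omega⟩
    · have h2 : (l : ℕ) = L - 1 := by rw [h]
      have h3 : -(H : ℤ) + 1 + (l : ℕ) = H := by omega
      rw [if_pos h, h3, if_pos rfl]
      push_cast; rfl
    · have h2 : (l : ℕ) ≠ L - 1 := fun h2 => h (Fin.ext h2)
      have h3 : -(H : ℤ) + 1 + (l : ℕ) ≠ H := by omega
      rw [if_neg h, if_neg h3, add_zero]
  simp_rw [hpow, mul_add]
  rw [Finset.sum_add_distrib]
  simp only [mul_ite, mul_zero, Finset.sum_ite_eq', Finset.mem_univ, if_true, bandIndex, hH2]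
  congr 2
  -- `2 α H = D` is an integer
  rw [show -(H : ℤ) + 1 + ((L - 1 : ℕ) : ℤ) = H by omega,
    ← ex_add_intCast (-(α * ((H : ℤ) : ℝ))) D]
  congr 1
  have : α * (2 * H) = D := by rw [← hHL, hα]; field_simp
  push_cast
  linarith

/-- The vector of correlations at lag zero is the image of the vector of subband powers. -/
lemma corrVec_eq_mulVec (hW : 0 < W) (hL : 0 < L) (hLeven : Even L) (hx : IsZeroMeanWSS P x r)
    (hS : IsPSD S r) (hband : IsBandLimited S W) (hc : ∀ i, c i < L) (a₀ : Fin q)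
    {z : Fin q → ℤ → Ω → ℝ}
    (hz : IsFilterOutput P (delayFilter L c) (mcSample x W L c) z) :
    (fun i => (corrVec P a₀ z i : ℂ)) = Psi a₀ L c *ᵥ fun l => (powerVec S W L l : ℂ) := by
  funext i
  rw [corrVec, crossCorr, hz.integral_mul hW hL hx hS hc]
  have h := integral_normDensity_mul_ex hW hL hLeven hS.integrable hband
    ((c (pairOf a₀ i).1 : ℤ) - c (pairOf a₀ i).2)
  have e : ∀ t : ℝ, (normDensity S W L t : ℂ) * (ex (((0 - 0 : ℤ) : ℝ) * t) *
      ex (((c (pairOf a₀ i).1 : ℝ) / L - (c (pairOf a₀ i).2 : ℝ) / L) * round t))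
      = (normDensity S W L t : ℂ) *
        ex (((((c (pairOf a₀ i).1 : ℤ) - c (pairOf a₀ i).2 : ℤ) : ℝ) / L : ℝ) * round t) := by
    intro t
    rw [sub_self, Int.cast_zero, zero_mul, ex_zero, one_mul]
    push_cast
    rw [sub_div]
  simp_rw [e]
  rw [h, Matrix.mulVec, dotProduct]
  refine Finset.sum_congr rfl fun l _ => ?_
  congr 1
  rw [Psi, Matrix.of_apply, ex_eq_exp]
  congr 1
  push_cast
  ring

end Bridge

/-! ### Time averages in a Hilbert space -/

section Hilbert

variable {E : Type*} [NormedAddCommGroup E] [InnerProductSpace ℝ E]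

/-- Time averages of inner products are not affected by perturbations that vanish in mean
square on time average. -/
lemma tendsto_mean_abs_inner_sub {f g : ℕ → E} {f' g' : ℕ → ℕ → E} {K : ℝ}
    (hf : ∀ n, ‖f n‖ ^ 2 ≤ K) (hg : ∀ n, ‖g n‖ ^ 2 ≤ K)
    (hf' : Tendsto (fun N : ℕ => (N : ℝ)⁻¹ * ∑ n ∈ Finset.range N, ‖f' N n - f n‖ ^ 2) atTop (𝓝 0))
    (hg' : Tendsto (fun N : ℕ => (N : ℝ)⁻¹ * ∑ n ∈ Finset.range N, ‖g' N n - g n‖ ^ 2)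
      atTop (𝓝 0)) :
    Tendsto (fun N : ℕ => (N : ℝ)⁻¹ * ∑ n ∈ Finset.range N,
      |inner ℝ (f' N n) (g' N n) - inner ℝ (f n) (g n)|) atTop (𝓝 0) := by
  have hK : 0 ≤ K := (sq_nonneg _).trans (hf 0)
  set e₁ : ℕ → ℝ := fun N => (N : ℝ)⁻¹ * ∑ n ∈ Finset.range N, ‖f' N n - f n‖ ^ 2 with he₁
  set e₂ : ℕ → ℝ := fun N => (N : ℝ)⁻¹ * ∑ n ∈ Finset.range N, ‖g' N n - g n‖ ^ 2 with he₂
  -- Young's inequality bounds the averages, for every `δ > 0`, by a null sequence plus `δ K`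
  have key : ∀ δ : ℝ, 0 < δ → ∀ N : ℕ, (N : ℝ)⁻¹ * ∑ n ∈ Finset.range N,
      |inner ℝ (f' N n) (g' N n) - inner ℝ (f n) (g n)|
      ≤ (1 + δ⁻¹) * (e₁ N + e₂ N) + δ * K := by
    intro δ hδ N
    have h1 : ∀ n, |inner ℝ (f' N n) (g' N n) - inner ℝ (f n) (g n)|
        ≤ (1 + δ⁻¹) * (‖f' N n - f n‖ ^ 2 + ‖g' N n - g n‖ ^ 2) + δ * K := by
      intro n
      have e : inner ℝ (f' N n) (g' N n) - inner ℝ (f n) (g n)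
          = inner ℝ (f' N n - f n) (g' N n - g n) + inner ℝ (f' N n - f n) (g n)
            + inner ℝ (f n) (g' N n - g n) := by
        simp only [inner_sub_left, inner_sub_right]; ring
      have b1 := abs_real_inner_le_norm (f' N n - f n) (g' N n - g n)
      have b2 := abs_real_inner_le_norm (f' N n - f n) (g n)
      have b3 := abs_real_inner_le_norm (f n) (g' N n - g n)
      have b := abs_add_three (inner ℝ (f' N n - f n) (g' N n - g n))
        (inner ℝ (f' N n - f n) (g n)) (inner ℝ (f n) (g' N n - g n))
      rw [e]
      have hfn := hf n
      have hgn := hg n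
      generalize ‖f' N n - f n‖ = a at *
      generalize ‖g' N n - g n‖ = d at *
      generalize ‖f n‖ = p at *
      generalize ‖g n‖ = p' at *
      have amgm : ∀ u v : ℝ, 2 * (u * v) ≤ δ⁻¹ * u ^ 2 + δ * v ^ 2 := by
        intro u v
        have h : δ⁻¹ * u ^ 2 + δ * v ^ 2 - 2 * (u * v) = δ⁻¹ * (u - δ * v) ^ 2 := by
          field_simp
          ring
        have : 0 ≤ δ⁻¹ * (u - δ * v) ^ 2 := by positivity
        linarith
      have m1 := amgm a p'
      have m2 := amgm d p
      have m3 : 0 ≤ (a - d) ^ 2 := sq_nonneg _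
      have m4 : δ * p ^ 2 ≤ δ * K := mul_le_mul_of_nonneg_left hfn hδ.le
      have m5 : δ * p' ^ 2 ≤ δ * K := mul_le_mul_of_nonneg_left hgn hδ.le
      have m6 : 0 ≤ δ⁻¹ * a ^ 2 := by positivity
      have m7 : 0 ≤ δ⁻¹ * d ^ 2 := by positivity
      nlinarith
    have h2 := Finset.sum_le_sum fun n (_ : n ∈ Finset.range N) => h1 n
    rw [Finset.sum_add_distrib, ← Finset.mul_sum, Finset.sum_add_distrib, Finset.sum_const,
      Finset.card_range, nsmul_eq_mul] at h2
    have h3 := mul_le_mul_of_nonneg_left h2 (by positivity : 0 ≤ (N : ℝ)⁻¹)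
    refine h3.trans ?_
    have h4 : (N : ℝ)⁻¹ * N ≤ 1 := inv_mul_le_one
    have h5 : (N : ℝ)⁻¹ * ((N : ℝ) * (δ * K)) ≤ δ * K := by
      rw [← mul_assoc]; exact mul_le_of_le_one_left (by positivity) h4
    simp only [he₁, he₂]
    linarith
  have he : Tendsto (fun N => e₁ N + e₂ N) atTop (𝓝 0) := by simpa using hf'.add hg'
  rw [Metric.tendsto_atTop]
  intro ε hε
  set δ := ε / (2 * (K + 1)) with hδ
  have hδ0 : 0 < δ := by positivity
  have hδK : δ * K < ε / 2 + 0 := by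
    rw [hδ, div_mul_eq_mul_div, add_zero, div_lt_div_iff₀ (by positivity) (by positivity)]
    nlinarith
  have hlim : Tendsto (fun N => (1 + δ⁻¹) * (e₁ N + e₂ N)) atTop (𝓝 0) := by
    simpa using he.const_mul (1 + δ⁻¹)
  obtain ⟨N₀, hN₀⟩ := (Metric.tendsto_atTop.1 hlim) (ε / 2) (by positivity)
  refine ⟨N₀, fun N hN => ?_⟩
  have h1 := hN₀ N hN
  rw [Real.dist_eq, sub_zero] at h1 ⊢
  rw [abs_of_nonneg (by positivity)]
  have h2 := key δ hδ0 N
  have h3 := le_abs_self ((1 + δ⁻¹) * (e₁ N + e₂ N))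
  linarith

lemma tendsto_mean_mean_sq_of_tendsto_zero {ρ : ℤ → ℝ} (hρ : Tendsto ρ cofinite (𝓝 0)) :
    Tendsto (fun N : ℕ => ((N : ℝ)⁻¹) ^ 2 * ∑ n ∈ Finset.range N, ∑ m ∈ Finset.range N,
      ρ ((n : ℤ) - m) ^ 2) atTop (𝓝 0) := by
  have hp : Tendsto (fun k : ℕ => ρ k ^ 2) atTop (𝓝 0) := by
    have := hρ.comp ((Nat.cast_injective (R := ℤ)).tendsto_cofinite)
    rw [Nat.cofinite_eq_atTop] at this
    simpa using this.pow 2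
  have hn : Tendsto (fun k : ℕ => ρ (-(k : ℤ)) ^ 2) atTop (𝓝 0) := by
    have := hρ.comp ((neg_injective.comp (Nat.cast_injective (R := ℤ))).tendsto_cofinite)
    rw [Nat.cofinite_eq_atTop] at this
    simpa using this.pow 2
  have hlim := hp.cesaro.add hn.cesaro
  rw [add_zero] at hlim
  refine squeeze_zero (fun N => by positivity) (fun N => ?_) hlim
  have h1 : ∀ n ∈ Finset.range N, ∑ m ∈ Finset.range N, ρ ((n : ℤ) - m) ^ 2
      ≤ ∑ k ∈ Finset.range N, ρ k ^ 2 + ∑ k ∈ Finset.range N, ρ (-(k : ℤ)) ^ 2 := by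
    intro n hn
    have hn' := Finset.mem_range.1 hn
    obtain ⟨d, rfl⟩ : ∃ d, N = (n + 1) + d := ⟨N - (n + 1), by omega⟩
    rw [Finset.sum_range_add]
    refine add_le_add ?_ ?_
    · rw [← Finset.sum_range_reflect]
      have : ∑ j ∈ Finset.range (n + 1), ρ ((n : ℤ) - ((n + 1 - 1 - j : ℕ) : ℤ)) ^ 2
          = ∑ j ∈ Finset.range (n + 1), ρ j ^ 2 := by
        refine Finset.sum_congr rfl fun j hj => ?_
        have := Finset.mem_range.1 hj
        congr 2
        omega
      rw [this]
      exact Finset.sum_le_sum_of_subset_of_nonneg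
        (Finset.range_mono (by omega)) fun _ _ _ => sq_nonneg _
    · have : ∑ j ∈ Finset.range d, ρ ((n : ℤ) - ((n + 1 + j : ℕ) : ℤ)) ^ 2
          = ∑ j ∈ Finset.range d, ρ (-((j + 1 : ℕ) : ℤ)) ^ 2 := by
        refine Finset.sum_congr rfl fun j _ => ?_
        congr 2
        push_cast; ring
      rw [this]
      have h2 := Finset.sum_range_succ' (fun j : ℕ => ρ (-(j : ℤ)) ^ 2) d
      have h3 : ∑ j ∈ Finset.range (d + 1), ρ (-(j : ℤ)) ^ 2
          ≤ ∑ j ∈ Finset.range (n + 1 + d), ρ (-(j : ℤ)) ^ 2 :=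
        Finset.sum_le_sum_of_subset_of_nonneg
          (Finset.range_mono (by omega)) fun _ _ _ => sq_nonneg _
      have h4 := sq_nonneg (ρ (-((0 : ℕ) : ℤ)))
      linarith
  have h2 := Finset.sum_le_sum h1
  rw [Finset.sum_const, Finset.card_range, nsmul_eq_mul] at h2
  set A := ∑ k ∈ Finset.range N, ρ k ^ 2 + ∑ k ∈ Finset.range N, ρ (-(k : ℤ)) ^ 2 with hA
  have hA0 : 0 ≤ A := by positivity
  rw [← mul_add, ← hA]
  calc ((N : ℝ)⁻¹) ^ 2 * _ ≤ ((N : ℝ)⁻¹) ^ 2 * (N * A) :=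
        mul_le_mul_of_nonneg_left h2 (by positivity)
    _ = (N : ℝ)⁻¹ * A * ((N : ℝ)⁻¹ * N) := by ring
    _ ≤ (N : ℝ)⁻¹ * A := mul_le_of_le_one_right (by positivity) inv_mul_le_one

/-- Double averages of squared inner products vanish if the unperturbed ones depend on the lag
only and vanish at infinity. -/
lemma tendsto_mean_mean_inner_sq {f g : ℕ → E} {f' g' : ℕ → ℕ → E} {K : ℝ} {ρ : ℤ → ℝ}
    (hf : ∀ n, ‖f n‖ ^ 2 ≤ K) (hg : ∀ n, ‖g n‖ ^ 2 ≤ K)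
    (hf' : Tendsto (fun N : ℕ => (N : ℝ)⁻¹ * ∑ n ∈ Finset.range N, ‖f' N n - f n‖ ^ 2) atTop (𝓝 0))
    (hg' : Tendsto (fun N : ℕ => (N : ℝ)⁻¹ * ∑ n ∈ Finset.range N, ‖g' N n - g n‖ ^ 2)
      atTop (𝓝 0))
    (hfg : ∀ n m : ℕ, inner ℝ (f n) (g m) = ρ ((n : ℤ) - m)) (hρ : Tendsto ρ cofinite (𝓝 0)) :
    Tendsto (fun N : ℕ => ((N : ℝ)⁻¹) ^ 2 * ∑ n ∈ Finset.range N, ∑ m ∈ Finset.range N,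
      inner ℝ (f' N n) (g' N m) ^ 2) atTop (𝓝 0) := by
  have hK : 0 ≤ K := (sq_nonneg _).trans (hf 0)
  set e₁ : ℕ → ℝ := fun N => (N : ℝ)⁻¹ * ∑ n ∈ Finset.range N, ‖f' N n - f n‖ ^ 2 with he₁
  set e₂ : ℕ → ℝ := fun N => (N : ℝ)⁻¹ * ∑ n ∈ Finset.range N, ‖g' N n - g n‖ ^ 2 with he₂
  have hlim : Tendsto (fun N : ℕ => 3 * (((N : ℝ)⁻¹) ^ 2 * ∑ n ∈ Finset.range N,
      ∑ m ∈ Finset.range N, ρ ((n : ℤ) - m) ^ 2) + 3 * (e₁ N * (2 * e₂ N + 2 * K)) + 3 * (K * e₂ N))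
      atTop (𝓝 0) := by
    have h1 := (tendsto_mean_mean_sq_of_tendsto_zero hρ).const_mul 3
    have h2 := (hf'.mul ((hg'.const_mul 2).add_const (2 * K))).const_mul 3
    have h3 := (hg'.const_mul K).const_mul 3
    simpa using (h1.add h2).add h3
  refine squeeze_zero (fun N => by positivity) (fun N => ?_) hlim
  have hterm : ∀ n m : ℕ, inner ℝ (f' N n) (g' N m) ^ 2 ≤ 3 * ρ ((n : ℤ) - m) ^ 2 +
      3 * (‖f' N n - f n‖ ^ 2 * (2 * ‖g' N m - g m‖ ^ 2 + 2 * K)) +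
      3 * (K * ‖g' N m - g m‖ ^ 2) := by
    intro n m
    have e : inner ℝ (f' N n) (g' N m) = ρ ((n : ℤ) - m) + inner ℝ (f' N n - f n) (g' N m)
        + inner ℝ (f n) (g' N m - g m) := by
      rw [← hfg]
      simp only [inner_sub_left, inner_sub_right]; ring
    have b2 := abs_real_inner_le_norm (f' N n - f n) (g' N m)
    have b3 := abs_real_inner_le_norm (f n) (g' N m - g m)
    have b4 : ‖g' N m‖ ^ 2 ≤ 2 * ‖g' N m - g m‖ ^ 2 + 2 * K := by
      have h1 := norm_add_le (g' N m - g m) (g m)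
      rw [sub_add_cancel] at h1
      have h2 := pow_le_pow_left₀ (norm_nonneg _) h1 2
      nlinarith [hg m, sq_nonneg (‖g' N m - g m‖ - ‖g m‖)]
    have c2 : inner ℝ (f' N n - f n) (g' N m) ^ 2
        ≤ ‖f' N n - f n‖ ^ 2 * (2 * ‖g' N m - g m‖ ^ 2 + 2 * K) := by
      rw [← sq_abs]
      refine (pow_le_pow_left₀ (abs_nonneg _) b2 2).trans ?_
      rw [mul_pow]
      exact mul_le_mul_of_nonneg_left b4 (sq_nonneg _)
    have c3 : inner ℝ (f n) (g' N m - g m) ^ 2 ≤ K * ‖g' N m - g m‖ ^ 2 := by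
      rw [← sq_abs]
      refine (pow_le_pow_left₀ (abs_nonneg _) b3 2).trans ?_
      rw [mul_pow]
      exact mul_le_mul_of_nonneg_right (hf n) (sq_nonneg _)
    rw [e]
    generalize inner ℝ (f' N n - f n) (g' N m) = u at *
    generalize inner ℝ (f n) (g' N m - g m) = v at *
    generalize ρ ((n : ℤ) - m) = w at *
    nlinarith [sq_nonneg (u - v), sq_nonneg (u - w), sq_nonneg (v - w)]
  have hN1 : (N : ℝ)⁻¹ * N ≤ 1 := inv_mul_le_one
  have he1 : 0 ≤ e₁ N := by positivity
  have he2 : 0 ≤ e₂ N := by positivity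
  have hsum := Finset.sum_le_sum fun n (_ : n ∈ Finset.range N) =>
    Finset.sum_le_sum fun m (_ : m ∈ Finset.range N) => hterm n m
  simp only [Finset.sum_add_distrib, ← Finset.mul_sum, ← Finset.sum_mul, Finset.sum_const,
    Finset.card_range, nsmul_eq_mul] at hsum
  set R := ∑ n ∈ Finset.range N, ∑ m ∈ Finset.range N, ρ ((n : ℤ) - m) ^ 2
  set F := ∑ n ∈ Finset.range N, ‖f' N n - f n‖ ^ 2
  set G := ∑ n ∈ Finset.range N, ‖g' N n - g n‖ ^ 2
  have hF : (N : ℝ)⁻¹ * F = e₁ N := rfl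
  have hG : (N : ℝ)⁻¹ * G = e₂ N := rfl
  refine (mul_le_mul_of_nonneg_left hsum (by positivity)).trans ?_
  have i1 : e₁ N * ((N : ℝ)⁻¹ * N) ≤ e₁ N := mul_le_of_le_one_right he1 hN1
  have i2 : e₂ N * ((N : ℝ)⁻¹ * N) ≤ e₂ N := mul_le_of_le_one_right he2 hN1
  have j1 := mul_le_mul_of_nonneg_left i1 hK
  have j2 := mul_le_mul_of_nonneg_left i2 hK
  generalize hy : (N : ℝ)⁻¹ = y at *
  have : y ^ 2 * (3 * R + 3 * (F * (2 * G + N * (2 * K))) + 3 * (N * (K * G)))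
      = 3 * (y ^ 2 * R) + 6 * ((y * F) * (y * G)) + 6 * (K * ((y * F) * (y * N)))
        + 3 * (K * ((y * G) * (y * N))) := by ring
  rw [hF, hG] at this
  linarith

end Hilbert

/-! ### Fourth moments of Gaussian families -/

lemma integral_pow_four_gaussianReal (v : NNReal) :
    ∫ y, y ^ 4 ∂(gaussianReal 0 v) = 3 * (v : ℝ) ^ 2 := by
  have h := iteratedDeriv_mgf_zero (X := id) (μ := gaussianReal 0 v) (by simp) 4
  rw [mgf_id_gaussianReal] at h
  have h' : ∫ y, y ^ 4 ∂(gaussianReal 0 v) = (gaussianReal 0 v)[id ^ 4] := rfl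
  rw [h', ← h]
  set f : ℝ → ℝ := fun t => Real.exp (0 * t + v * t ^ 2 / 2) with hf
  have hf1 : ∀ t, HasDerivAt f (v * t * f t) t := by
    intro t
    have : HasDerivAt (fun t : ℝ => 0 * t + v * t ^ 2 / 2) (v * t) t := by
      have h1 := ((hasDerivAt_pow 2 t).const_mul (v : ℝ)).div_const 2
      have h2 := ((hasDerivAt_id t).const_mul (0 : ℝ)).add h1
      refine h2.congr_deriv ?_
      norm_num; ring
    exact this.exp.congr_deriv (by simp only [hf]; ring)
  have step : ∀ (p p' : ℝ → ℝ), (∀ t, HasDerivAt p (p' t) t) →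
      deriv (fun t => p t * f t) = fun t => (p' t + p t * (v * t)) * f t := by
    intro p p' hp
    funext t
    have h2 : HasDerivAt (fun t => p t * f t) _ t := (hp t).mul (hf1 t)
    rw [h2.deriv]
    ring
  have d1 : deriv f = fun t => v * t * f t := funext fun t => (hf1 t).deriv
  have q1 : ∀ t : ℝ, HasDerivAt (fun t : ℝ => (v : ℝ) * t) v t := fun t => by
    simpa using (hasDerivAt_id t).const_mul (v : ℝ)
  have d2 := step _ _ q1
  have q2 : ∀ t : ℝ, HasDerivAt (fun t : ℝ => (v : ℝ) + v * t * (v * t)) (2 * v ^ 2 * t) t :=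
    fun t => (((q1 t).mul (q1 t)).const_add (v : ℝ)).congr_deriv (by ring)
  have d3 := step _ _ q2
  have q3 : ∀ t : ℝ, HasDerivAt
      (fun t : ℝ => 2 * (v : ℝ) ^ 2 * t + (v + v * t * (v * t)) * (v * t))
      (2 * v ^ 2 + ((2 * v ^ 2 * t) * (v * t) + (v + v * t * (v * t)) * v)) t := fun t => by
    refine (((hasDerivAt_id t).const_mul (2 * (v : ℝ) ^ 2)).add ((q2 t).mul (q1 t))).congr_deriv ?_
    ring
  have d4 := step _ _ q3
  rw [iteratedDeriv_succ, iteratedDeriv_succ, iteratedDeriv_succ, iteratedDeriv_one, d1, d2, d3, d4]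
  simp [hf]
  ring

lemma holderTriple_four_four_two : ENNReal.HolderTriple 4 4 2 := by
  refine ⟨?_⟩
  rw [← two_mul, show (4 : ℝ≥0∞) = 2 * 2 by norm_num, ENNReal.mul_inv (by simp) (by simp),
    ← mul_assoc, ENNReal.mul_inv_cancel (by simp) (by simp), one_mul]

/-- A linear space of random variables with finite fourth moments that satisfy the moment identity
`E Y⁴ = 3 (E Y²)²` of a centred Gaussian variable. -/
structure HasGaussianMoments {Ω : Type*} [MeasurableSpace Ω] (P : Measure Ω)
    (V : Submodule ℝ (Ω → ℝ)) : Prop where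
  memLp : ∀ Y ∈ V, MemLp Y 4 P
  pow_four : ∀ Y ∈ V, ∫ ω, Y ω ^ 4 ∂P = 3 * (∫ ω, Y ω ^ 2 ∂P) ^ 2

section Gaussian

variable {Ω : Type*} [MeasurableSpace Ω] {P : Measure Ω}

lemma hasGaussianMoments_span {ι : Type*} {Y : ι → Ω → ℝ} (hY : IsGaussianProcess Y P)
    (h0 : ∀ i, ∫ ω, Y i ω ∂P = 0) : HasGaussianMoments P (Submodule.span ℝ (Set.range Y)) := by
  have hG : ∀ Z ∈ Submodule.span ℝ (Set.range Y), HasGaussianLaw Z P ∧ ∫ ω, Z ω ∂P = 0 := by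
    intro Z hZ
    obtain ⟨a, rfl⟩ := Finsupp.mem_span_range_iff_exists_finsupp.1 hZ
    have h1 := (hY.smul a).hasGaussianLaw_fun_sum (I := a.support)
    have e : (a.sum fun i c => c • Y i) = fun ω => ∑ i ∈ a.support, a i • Y i ω := by
      funext ω
      rw [Finsupp.sum, Finset.sum_apply]
      rfl
    rw [e]
    refine ⟨h1, ?_⟩
    rw [integral_finsetSum]
    · refine Finset.sum_eq_zero fun i _ => ?_
      rw [integral_smul, h0, smul_zero]
    · intro i _
      exact Integrable.smul (a i) (hY.hasGaussianLaw_eval i).integrable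
  refine ⟨fun Z hZ => (hG Z hZ).1.memLp (by simp), fun Z hZ => ?_⟩
  obtain ⟨h1, h2⟩ := hG Z hZ
  have hP := hY.isProbabilityMeasure
  have hm := h1.aemeasurable
  have hlaw := h1.map_eq_gaussianReal
  rw [h2] at hlaw
  have e4 : ∫ ω, Z ω ^ 4 ∂P = ∫ y, y ^ 4 ∂(P.map Z) :=
    (integral_map hm (continuous_pow 4).aestronglyMeasurable).symm
  rw [e4, hlaw, integral_pow_four_gaussianReal, Real.coe_toNNReal _ (variance_nonneg _ _),
    variance_of_integral_eq_zero hm h2]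

namespace HasGaussianMoments

variable {V : Submodule ℝ (Ω → ℝ)}

lemma memLp_mul (hV : HasGaussianMoments P V) {A B : Ω → ℝ} (hA : A ∈ V) (hB : B ∈ V) :
    MemLp (fun ω => A ω * B ω) 2 P := by
  have := holderTriple_four_four_two
  exact (hV.memLp B hB).mul (hV.memLp A hA)

lemma memLp_two [IsFiniteMeasure P] (hV : HasGaussianMoments P V) {A : Ω → ℝ} (hA : A ∈ V) :
    MemLp A 2 P := (hV.memLp A hA).mono_exponent (by norm_num)

lemma integrable_mul_mul (hV : HasGaussianMoments P V) {A B C D : Ω → ℝ} (hA : A ∈ V) (hB : B ∈ V)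
    (hC : C ∈ V) (hD : D ∈ V) : Integrable (fun ω => A ω * B ω * (C ω * D ω)) P :=
  (hV.memLp_mul hA hB).integrable_mul (hV.memLp_mul hC hD)

lemma integral_mul_add [IsFiniteMeasure P] (hV : HasGaussianMoments P V) {A B C : Ω → ℝ}
    (hA : A ∈ V) (hB : B ∈ V) (hC : C ∈ V) :
    ∫ ω, A ω * (B + C) ω ∂P = ∫ ω, A ω * B ω ∂P + ∫ ω, A ω * C ω ∂P := by
  simp only [Pi.add_apply, mul_add]
  exact integral_add ((hV.memLp_two hA).integrable_mul (hV.memLp_two hB))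
    ((hV.memLp_two hA).integrable_mul (hV.memLp_two hC))

lemma integral_mul_sub [IsFiniteMeasure P] (hV : HasGaussianMoments P V) {A B C : Ω → ℝ}
    (hA : A ∈ V) (hB : B ∈ V) (hC : C ∈ V) :
    ∫ ω, A ω * (B - C) ω ∂P = ∫ ω, A ω * B ω ∂P - ∫ ω, A ω * C ω ∂P := by
  simp only [Pi.sub_apply, mul_sub]
  exact integral_sub ((hV.memLp_two hA).integrable_mul (hV.memLp_two hB))
    ((hV.memLp_two hA).integrable_mul (hV.memLp_two hC))

lemma integral_sq_add_sub [IsFiniteMeasure P] (hV : HasGaussianMoments P V) {A B : Ω → ℝ}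
    (hA : A ∈ V) (hB : B ∈ V) :
    ∫ ω, (A + B) ω ^ 2 ∂P = ∫ ω, A ω ^ 2 ∂P + 2 * ∫ ω, A ω * B ω ∂P + ∫ ω, B ω ^ 2 ∂P ∧
    ∫ ω, (A - B) ω ^ 2 ∂P = ∫ ω, A ω ^ 2 ∂P - 2 * ∫ ω, A ω * B ω ∂P + ∫ ω, B ω ^ 2 ∂P := by
  have iA := (hV.memLp_two hA).integrable_sq
  have iB := (hV.memLp_two hB).integrable_sq
  have iAB : Integrable (fun ω => 2 * (A ω * B ω)) P :=
    ((hV.memLp_two hA).integrable_mul (hV.memLp_two hB)).const_mul 2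
  have i1 : Integrable (fun ω => A ω ^ 2 + 2 * (A ω * B ω)) P := iA.add iAB
  have i2 : Integrable (fun ω => A ω ^ 2 - 2 * (A ω * B ω)) P := iA.sub iAB
  constructor
  · rw [← integral_const_mul, ← integral_add iA iAB, ← integral_add i1 iB]
    refine integral_congr_ae (ae_of_all _ fun ω => ?_)
    simp only [Pi.add_apply]; ring
  · rw [← integral_const_mul, ← integral_sub iA iAB, ← integral_add i2 iB]
    refine integral_congr_ae (ae_of_all _ fun ω => ?_)
    simp only [Pi.sub_apply]; ring

/-- `E A²B² = E A² E B² + 2 (E AB)²`, by polarization of the fourth moment. -/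
lemma integral_sq_mul_sq [IsFiniteMeasure P] (hV : HasGaussianMoments P V) {A B : Ω → ℝ}
    (hA : A ∈ V) (hB : B ∈ V) :
    ∫ ω, A ω * A ω * (B ω * B ω) ∂P
      = (∫ ω, A ω ^ 2 ∂P) * (∫ ω, B ω ^ 2 ∂P) + 2 * (∫ ω, A ω * B ω ∂P) ^ 2 := by
  have hp := V.add_mem hA hB
  have hm := V.sub_mem hA hB
  have i4 : ∀ Y ∈ V, Integrable (fun ω => Y ω ^ 4) P := fun Y hY =>
    (hV.integrable_mul_mul hY hY hY hY).congr (ae_of_all _ fun ω => by ring)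
  have iAB : Integrable (fun ω => 12 * (A ω * A ω * (B ω * B ω))) P :=
    (hV.integrable_mul_mul hA hA hB hB).const_mul 12
  have iS : Integrable (fun ω => 2 * A ω ^ 4 + 12 * (A ω * A ω * (B ω * B ω))) P :=
    ((i4 A hA).const_mul 2).add iAB
  have e : ∫ ω, (A + B) ω ^ 4 ∂P + ∫ ω, (A - B) ω ^ 4 ∂P
      = ∫ ω, 2 * A ω ^ 4 ∂P + ∫ ω, 12 * (A ω * A ω * (B ω * B ω)) ∂P + ∫ ω, 2 * B ω ^ 4 ∂P := by
    rw [← integral_add (i4 _ hp) (i4 _ hm), ← integral_add ((i4 A hA).const_mul 2) iAB,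
      ← integral_add iS ((i4 B hB).const_mul 2)]
    refine integral_congr_ae (ae_of_all _ fun ω => ?_)
    simp only [Pi.add_apply, Pi.sub_apply]; ring
  rw [integral_const_mul, integral_const_mul, integral_const_mul, hV.pow_four _ hp,
    hV.pow_four _ hm, hV.pow_four _ hA, hV.pow_four _ hB, (hV.integral_sq_add_sub hA hB).1,
    (hV.integral_sq_add_sub hA hB).2] at e
  linarith

lemma integral_sq_mul_mul [IsFiniteMeasure P] (hV : HasGaussianMoments P V) {A C D : Ω → ℝ}
    (hA : A ∈ V) (hC : C ∈ V) (hD : D ∈ V) :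
    ∫ ω, A ω * A ω * (C ω * D ω) ∂P = (∫ ω, A ω ^ 2 ∂P) * (∫ ω, C ω * D ω ∂P)
      + 2 * ((∫ ω, A ω * C ω ∂P) * ∫ ω, A ω * D ω ∂P) := by
  have hp := V.add_mem hC hD
  have hm := V.sub_mem hC hD
  have e : 4 * ∫ ω, A ω * A ω * (C ω * D ω) ∂P
      = ∫ ω, A ω * A ω * ((C + D) ω * (C + D) ω) ∂P
        - ∫ ω, A ω * A ω * ((C - D) ω * (C - D) ω) ∂P := by
    rw [← integral_const_mul, ← integral_sub (hV.integrable_mul_mul hA hA hp hp)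
      (hV.integrable_mul_mul hA hA hm hm)]
    refine integral_congr_ae (ae_of_all _ fun ω => ?_)
    simp only [Pi.add_apply, Pi.sub_apply]; ring
  rw [hV.integral_sq_mul_sq hA hp, hV.integral_sq_mul_sq hA hm, hV.integral_mul_add hA hC hD,
    hV.integral_mul_sub hA hC hD, (hV.integral_sq_add_sub hC hD).1,
    (hV.integral_sq_add_sub hC hD).2] at e
  linarith

/-- Isserlis' formula for four variables. -/
lemma integral_mul_mul_mul [IsFiniteMeasure P] (hV : HasGaussianMoments P V) {A B C D : Ω → ℝ}
    (hA : A ∈ V) (hB : B ∈ V) (hC : C ∈ V) (hD : D ∈ V) :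
    ∫ ω, A ω * B ω * (C ω * D ω) ∂P = (∫ ω, A ω * B ω ∂P) * (∫ ω, C ω * D ω ∂P)
      + (∫ ω, A ω * C ω ∂P) * (∫ ω, B ω * D ω ∂P)
      + (∫ ω, A ω * D ω ∂P) * (∫ ω, B ω * C ω ∂P) := by
  have hp := V.add_mem hA hB
  have hm := V.sub_mem hA hB
  have e : 4 * ∫ ω, A ω * B ω * (C ω * D ω) ∂P
      = ∫ ω, (A + B) ω * (A + B) ω * (C ω * D ω) ∂P
        - ∫ ω, (A - B) ω * (A - B) ω * (C ω * D ω) ∂P := by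
    rw [← integral_const_mul, ← integral_sub (hV.integrable_mul_mul hp hp hC hD)
      (hV.integrable_mul_mul hm hm hC hD)]
    refine integral_congr_ae (ae_of_all _ fun ω => ?_)
    simp only [Pi.add_apply, Pi.sub_apply]; ring
  have s : ∀ Y Z : Ω → ℝ, ∫ ω, Y ω * Z ω ∂P = ∫ ω, Z ω * Y ω ∂P := fun Y Z => by
    simp_rw [mul_comm]
  rw [hV.integral_sq_mul_mul hp hC hD, hV.integral_sq_mul_mul hm hC hD,
    (hV.integral_sq_add_sub hA hB).1, (hV.integral_sq_add_sub hA hB).2, s (A + B) C, s (A + B) D,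
    s (A - B) C, s (A - B) D, hV.integral_mul_add hC hA hB, hV.integral_mul_add hD hA hB,
    hV.integral_mul_sub hC hA hB, hV.integral_mul_sub hD hA hB, s C A, s C B, s D A, s D B] at e
  linarith

/-- The sample correlations of a Gaussian family have finite variance. -/
lemma memLp_sampleCorr (hV : HasGaussianMoments P V) {f g : ℤ → Ω → ℝ} (hf : ∀ n, f n ∈ V)
    (hg : ∀ n, g n ∈ V) (N : ℕ) : MemLp (sampleCorr f g N) 2 P := by
  have := (memLp_finsetSum (Finset.range N) fun (n : ℕ) _ =>
    hV.memLp_mul (hf n) (hg n)).const_mul (1 / (N : ℝ))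
  exact this

/-- The variance of a sample correlation of a Gaussian family, by Isserlis' formula. -/
lemma variance_sampleCorr_le [IsProbabilityMeasure P] (hV : HasGaussianMoments P V)
    {f g : ℤ → Ω → ℝ} (hf : ∀ n, f n ∈ V) (hg : ∀ n, g n ∈ V) (N : ℕ) :
    variance (sampleCorr f g N) P ≤
      ((N : ℝ)⁻¹) ^ 2 * (∑ n ∈ Finset.range N, ∑ m ∈ Finset.range N,
        (∫ ω, f n ω * f m ω ∂P) ^ 2) +
      ((N : ℝ)⁻¹) ^ 2 * (∑ n ∈ Finset.range N, ∑ m ∈ Finset.range N,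
        (∫ ω, g n ω * g m ω ∂P) ^ 2) +
      ((N : ℝ)⁻¹) ^ 2 * (∑ n ∈ Finset.range N, ∑ m ∈ Finset.range N,
        (∫ ω, f n ω * g m ω ∂P) ^ 2) +
      ((N : ℝ)⁻¹) ^ 2 * (∑ n ∈ Finset.range N, ∑ m ∈ Finset.range N,
        (∫ ω, g n ω * f m ω ∂P) ^ 2) := by
  have i2 : ∀ n : ℕ, Integrable (fun ω => f n ω * g n ω) P := fun n =>
    (hV.memLp_mul (hf n) (hg n)).integrable (by norm_num)
  have h1 : ∫ ω, sampleCorr f g N ω ∂P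
      = (N : ℝ)⁻¹ * ∑ n ∈ Finset.range N, ∫ ω, f n ω * g n ω ∂P := by
    simp only [sampleCorr, one_div]
    rw [integral_const_mul, integral_finsetSum _ fun n _ => i2 n]
  have h2 : ∫ ω, (sampleCorr f g N ^ 2) ω ∂P = ((N : ℝ)⁻¹) ^ 2 * ∑ n ∈ Finset.range N,
      ∑ m ∈ Finset.range N, ∫ ω, f n ω * g n ω * (f m ω * g m ω) ∂P := by
    have e : ∀ ω, (sampleCorr f g N ^ 2) ω = ((N : ℝ)⁻¹) ^ 2 * ∑ n ∈ Finset.range N,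
        ∑ m ∈ Finset.range N, f n ω * g n ω * (f m ω * g m ω) := by
      intro ω
      rw [Pi.pow_apply, sampleCorr, one_div, mul_pow, sq (∑ n ∈ Finset.range N, f n ω * g n ω),
        Finset.sum_mul_sum]
    simp_rw [e]
    have hi : ∀ n m : ℕ, Integrable (fun ω => f n ω * g n ω * (f m ω * g m ω)) P := fun n m =>
      hV.integrable_mul_mul (hf n) (hg n) (hf m) (hg m)
    rw [integral_const_mul,
      integral_finsetSum _ fun n _ => integrable_finsetSum _ fun m _ => hi n m]
    congr 1
    refine Finset.sum_congr rfl fun n _ => ?_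
    rw [integral_finsetSum _ fun m _ => hi n m]
  rw [variance_eq_sub (hV.memLp_sampleCorr hf hg N), h1, h2, mul_pow,
    sq (∑ n ∈ Finset.range N, ∫ ω, f n ω * g n ω ∂P), Finset.sum_mul_sum, ← mul_sub, ← mul_add,
    ← mul_add, ← mul_add]
  simp only [← Finset.sum_sub_distrib, ← Finset.sum_add_distrib]
  refine mul_le_mul_of_nonneg_left (Finset.sum_le_sum fun n _ => Finset.sum_le_sum fun m _ => ?_)
    (by positivity)
  rw [hV.integral_mul_mul_mul (hf n) (hg n) (hf m) (hg m)]
  generalize ∫ ω, f n ω * f m ω ∂P = p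
  generalize ∫ ω, g n ω * g m ω ∂P = p'
  generalize ∫ ω, f n ω * g m ω ∂P = p''
  generalize ∫ ω, g n ω * f m ω ∂P = p'''
  nlinarith [sq_nonneg (p - p'), sq_nonneg (p'' - p'''), sq_nonneg (p + p'), sq_nonneg (p'' + p''')]

end HasGaussianMoments

end Gaussian

/-! ### The sample correlations -/

lemma delayedObs_mem {Ω : Type*} (V : Submodule ℝ (Ω → ℝ)) {h : ℤ → ℝ} {y : ℤ → Ω → ℝ} (hy : ∀ n, y n ∈ V)
    (N : ℕ) (n : ℤ) : delayedObs h y N n ∈ V := by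
  have : delayedObs h y N n = ∑ k ∈ Finset.range N, h (n - k) • y k := by
    funext ω
    rw [delayedObs_eq_sum, Finset.sum_apply]
    rfl
  rw [this]
  exact V.sum_mem fun k _ => V.smul_mem _ (hy _)

section SampleCorrelations

variable {Ω : Type*} [MeasurableSpace Ω] {P : Measure Ω} {x : ℝ → Ω → ℝ} {r S : ℝ → ℝ} {W : ℝ}
  {q L : ℕ} {c : Fin q → ℕ} {z : Fin q → ℤ → Ω → ℝ}

lemma memLp_delayedObs (hW : 0 < W) (hL : 0 < L) (hx : IsZeroMeanWSS P x r) (hS : IsPSD S r)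
    (i : Fin q) (N n : ℕ) :
    MemLp (delayedObs (delayFilter L c i) (mcSample x W L c i) N n) 2 P := by
  have h := (hasSpectralDensity_normDensity hW hL hx hS).memLp_linearCombination
    (obsCoeff ((c i : ℝ) / L) N n)
  rwa [show Finsupp.linearCombination ℝ (fun T => x (T * L / W)) (obsCoeff ((c i : ℝ) / L) N n)
    = delayedObs (delayFilter L c i) (mcSample x W L c i) N n from
      funext fun ω => linearCombination_obsCoeff hL i N n ω] at h

lemma tendsto_mean_norm_sq_delayedObs_sub (hW : 0 < W) (hL : 0 < L) (hx : IsZeroMeanWSS P x r)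
    (hS : IsPSD S r) (hc : ∀ i, c i < L)
    (hz : IsFilterOutput P (delayFilter L c) (mcSample x W L c) z) (i : Fin q) :
    Tendsto (fun N : ℕ => (N : ℝ)⁻¹ * ∑ n ∈ Finset.range N,
      ‖(memLp_delayedObs (c := c) hW hL hx hS i N n).toLp _ - (hz i n).1.toLp _‖ ^ 2)
      atTop (𝓝 0) := by
  have h := (hasSpectralDensity_normDensity hW hL hx hS).tendsto_mean_edge (delay_mem hc i).1
    (delay_mem hc i).2 (hz.hasSymbol hL hc i)
  refine h.congr fun N => ?_
  congr 1
  refine Finset.sum_congr rfl fun n _ => ?_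
  rw [← MemLp.toLp_sub, norm_toLp_sq_eq_integral]
  simp only [linearCombination_obsCoeff hL, Pi.sub_apply]

lemma IsFilterOutput.integral_mul_eq_crossCorr (hW : 0 < W) (hL : 0 < L)
    (hx : IsZeroMeanWSS P x r) (hS : IsPSD S r) (hc : ∀ i, c i < L)
    (hz : IsFilterOutput P (delayFilter L c) (mcSample x W L c) z) (a b : Fin q) (n m : ℤ) :
    ∫ ω, z a n ω * z b m ω ∂P = crossCorr P (z a) (z b) (n - m) := by
  have h1 := hz.integral_mul hW hL hx hS hc a b n m
  have h2 := hz.integral_mul hW hL hx hS hc a b (n - m) 0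
  rw [sub_zero, ← h1] at h2
  rw [crossCorr]
  exact_mod_cast h2.symm

/-- Integrability of the spectral density makes the correlations of the delayed sequences vanish at
infinity. -/
lemma IsFilterOutput.tendsto_crossCorr (hW : 0 < W) (hL : 0 < L) (hx : IsZeroMeanWSS P x r)
    (hS : IsPSD S r) (hc : ∀ i, c i < L)
    (hz : IsFilterOutput P (delayFilter L c) (mcSample x W L c) z) (a b : Fin q) :
    Tendsto (crossCorr P (z a) (z b)) cofinite (𝓝 0) := by
  have h := tendsto_corr_cofinite (normDensity S W L) ((c a : ℝ) / L - (c b : ℝ) / L)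
  have h2 : Tendsto (fun k : ℤ => ((crossCorr P (z a) (z b) k : ℝ) : ℂ)) cofinite (𝓝 0) := by
    refine h.congr fun k => ?_
    rw [crossCorr, hz.integral_mul hW hL hx hS hc, sub_zero]
  have h3 := (Complex.continuous_re.tendsto _).comp h2
  simpa [Function.comp_def] using h3

lemma IsFilterOutput.norm_toLp_sq_le (hW : 0 < W) (hL : 0 < L) (hx : IsZeroMeanWSS P x r)
    (hS : IsPSD S r) (hc : ∀ i, c i < L)
    (hz : IsFilterOutput P (delayFilter L c) (mcSample x W L c) z) (a : Fin q) (n : ℤ) :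
    ‖(hz a n).1.toLp _‖ ^ 2 ≤ ∑ b, crossCorr P (z b) (z b) 0 := by
  have h : ∀ b, ‖(hz b n).1.toLp _‖ ^ 2 = crossCorr P (z b) (z b) 0 := by
    intro b
    rw [← real_inner_self_eq_norm_sq, inner_toLp_eq_integral,
      hz.integral_mul_eq_crossCorr hW hL hx hS hc, sub_self]
  rw [h]
  exact Finset.single_le_sum (f := fun b => crossCorr P (z b) (z b) 0)
    (fun b _ => by rw [← h]; positivity) (Finset.mem_univ a)

/-- In the Hilbert space `L²(P)` the expectation of a sample correlation is an average of inner products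
of windowed outputs, which differ from the ideal outputs by an edge effect that
vanishes in mean square on time average. -/
lemma asympUnbiased_corrEst (hW : 0 < W) (hL : 0 < L) (hx : IsZeroMeanWSS P x r)
    (hS : IsPSD S r) (hc : ∀ i, c i < L) (a₀ : Fin q)
    (hz : IsFilterOutput P (delayFilter L c) (mcSample x W L c) z) :
    AsympUnbiased P (corrEst a₀ (delayFilter L c) (mcSample x W L c)) (corrVec P a₀ z) := by
  intro i
  set a := (pairOf a₀ i).1 with ha
  set b := (pairOf a₀ i).2 with hb
  have hint : ∀ N n : ℕ, Integrable (fun ω =>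
      delayedObs (delayFilter L c a) (mcSample x W L c a) N n ω *
        delayedObs (delayFilter L c b) (mcSample x W L c b) N n ω) P := fun N n =>
    (memLp_delayedObs hW hL hx hS a N n).integrable_mul (memLp_delayedObs hW hL hx hS b N n)
  refine ⟨fun N => (integrable_finsetSum _ fun n _ => hint N n).const_mul _, ?_⟩
  have hE : ∀ N : ℕ, ∫ ω, corrEst a₀ (delayFilter L c) (mcSample x W L c) N ω i ∂P
      = (N : ℝ)⁻¹ * ∑ n ∈ Finset.range N, ∫ ω,
        delayedObs (delayFilter L c a) (mcSample x W L c a) N n ω *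
          delayedObs (delayFilter L c b) (mcSample x W L c b) N n ω ∂P := by
    intro N
    simp only [corrEst, sampleCorr, one_div]
    rw [integral_const_mul, integral_finsetSum _ fun n _ => hint N n]
  have h := tendsto_mean_abs_inner_sub
    (fun n : ℕ => hz.norm_toLp_sq_le hW hL hx hS hc a n)
    (fun n : ℕ => hz.norm_toLp_sq_le hW hL hx hS hc b n)
    (tendsto_mean_norm_sq_delayedObs_sub hW hL hx hS hc hz a)
    (tendsto_mean_norm_sq_delayedObs_sub hW hL hx hS hc hz b)
  simp only [inner_toLp_eq_integral] at h
  rw [tendsto_iff_norm_sub_tendsto_zero]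
  refine squeeze_zero' (Eventually.of_forall fun _ => norm_nonneg _) ?_ h
  filter_upwards [eventually_gt_atTop 0] with N hN
  have hN' : (N : ℝ) ≠ 0 := by exact_mod_cast hN.ne'
  have hu : corrVec P a₀ z i
      = (N : ℝ)⁻¹ * ∑ n ∈ Finset.range N, ∫ ω, z a n ω * z b n ω ∂P := by
    simp_rw [hz.integral_mul_eq_crossCorr hW hL hx hS hc, sub_self]
    rw [Finset.sum_const, Finset.card_range, nsmul_eq_mul, inv_mul_cancel_left₀ hN', corrVec]
  rw [hE, hu, ← mul_sub, ← Finset.sum_sub_distrib, norm_mul, Real.norm_eq_abs,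
    abs_of_nonneg (by positivity), Real.norm_eq_abs]
  exact mul_le_mul_of_nonneg_left (Finset.abs_sum_le_sum_abs _ _) (by positivity)

/-- Isserlis' formula reduces the variance to double averages of squared correlations, whose lags
spread out as the window grows; they vanish because the correlations tend to zero at infinity. -/
lemma memLp_and_tendsto_variance_corrEst [IsProbabilityMeasure P] (hW : 0 < W) (hL : 0 < L)
    (hx : IsZeroMeanWSS P x r) (hS : IsPSD S r) (hc : ∀ i, c i < L) (a₀ : Fin q)
    (hz : IsFilterOutput P (delayFilter L c) (mcSample x W L c) z) (i : PairIndex q)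
    (hG : JointlyGaussian P (mcSample x W L c (pairOf a₀ i).1) (mcSample x W L c (pairOf a₀ i).2)) :
    (∀ N, MemLp (fun ω => corrEst a₀ (delayFilter L c) (mcSample x W L c) N ω i) 2 P) ∧
      Tendsto (fun N => variance
        (fun ω => corrEst a₀ (delayFilter L c) (mcSample x W L c) N ω i) P) atTop (𝓝 0) := by
  set a := (pairOf a₀ i).1 with ha
  set b := (pairOf a₀ i).2 with hb
  have hV := hasGaussianMoments_span hG (by rintro (n | n) <;> exact hx.mean_zero _)
  set V := Submodule.span ℝ
    (Set.range (Sum.elim (mcSample x W L c a) (mcSample x W L c b))) with hVdef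
  have hya : ∀ n, mcSample x W L c a n ∈ V := fun n => Submodule.subset_span ⟨Sum.inl n, rfl⟩
  have hyb : ∀ n, mcSample x W L c b n ∈ V := fun n => Submodule.subset_span ⟨Sum.inr n, rfl⟩
  refine ⟨fun N => hV.memLp_sampleCorr (delayedObs_mem V hya N) (delayedObs_mem V hyb N) N, ?_⟩
  have key : ∀ d e : Fin q, Tendsto (fun N : ℕ => ((N : ℝ)⁻¹) ^ 2 *
      ∑ n ∈ Finset.range N, ∑ m ∈ Finset.range N,
        (∫ ω, delayedObs (delayFilter L c d) (mcSample x W L c d) N n ω *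
          delayedObs (delayFilter L c e) (mcSample x W L c e) N m ω ∂P) ^ 2) atTop (𝓝 0) := by
    intro d e
    have h := tendsto_mean_mean_inner_sq (ρ := crossCorr P (z d) (z e))
      (fun n : ℕ => hz.norm_toLp_sq_le hW hL hx hS hc d n)
      (fun n : ℕ => hz.norm_toLp_sq_le hW hL hx hS hc e n)
      (tendsto_mean_norm_sq_delayedObs_sub hW hL hx hS hc hz d)
      (tendsto_mean_norm_sq_delayedObs_sub hW hL hx hS hc hz e)
      (fun n m => by
        rw [inner_toLp_eq_integral, hz.integral_mul_eq_crossCorr hW hL hx hS hc])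
      (hz.tendsto_crossCorr hW hL hx hS hc d e)
    simpa only [inner_toLp_eq_integral] using h
  have hlim := (((key a a).add (key b b)).add (key a b)).add (key b a)
  simp only [add_zero] at hlim
  exact squeeze_zero (fun N => variance_nonneg _ _) (fun N =>
    hV.variance_sampleCorr_le (delayedObs_mem V hya N) (delayedObs_mem V hyb N) N) hlim

end SampleCorrelations

/-! ### Linear transformations of consistent estimators -/

section Estimators

variable {Ω ι κ 𝕜 : Type*} [MeasurableSpace Ω] [RCLike 𝕜] {P : Measure Ω}

lemma AsympUnbiased.mulVec [Fintype ι] {U : ℕ → Ω → ι → 𝕜} {u : ι → 𝕜}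
    (h : AsympUnbiased P U u) (A : Matrix κ ι 𝕜) :
    AsympUnbiased P (fun N ω => A *ᵥ U N ω) (A *ᵥ u) := by
  intro l
  have hi : ∀ N j, Integrable (fun ω => A l j * U N ω j) P := fun N j =>
    ((h j).1 N).const_mul (A l j)
  refine ⟨fun N => integrable_finsetSum _ fun j _ => hi N j, ?_⟩
  have e : ∀ N, ∫ ω, (A *ᵥ U N ω) l ∂P = ∑ j, A l j * ∫ ω, U N ω j ∂P := by
    intro N
    simp only [Matrix.mulVec, dotProduct]
    rw [integral_finsetSum _ fun j _ => hi N j]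
    exact Finset.sum_congr rfl fun j _ => integral_const_mul _ _
  simp_rw [e]
  exact tendsto_finsetSum _ fun j _ => (h j).2.const_mul (A l j)

/-- `est N` has finite second moments and converges to `v` in mean square. -/
def MeanSquareConsistent (P : Measure Ω) (est : ℕ → Ω → κ → 𝕜) (v : κ → 𝕜) : Prop :=
  ∀ l, (∀ N, MemLp (fun ω => est N ω l) 2 P) ∧
    Tendsto (fun N => ∫ ω, ‖est N ω l - v l‖ ^ 2 ∂P) atTop (𝓝 0)

lemma integrable_norm_sq {f : Ω → 𝕜} (hf : MemLp f 2 P) : Integrable (fun ω => ‖f ω‖ ^ 2) P :=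
  hf.norm.integrable_sq

lemma MeanSquareConsistent.mulVec [Fintype ι] [IsFiniteMeasure P] {U : ℕ → Ω → ι → 𝕜} {u : ι → 𝕜}
    (h : MeanSquareConsistent P U u) (A : Matrix κ ι 𝕜) :
    MeanSquareConsistent P (fun N ω => A *ᵥ U N ω) (A *ᵥ u) := by
  intro l
  have hm : ∀ N, MemLp (fun ω => (A *ᵥ U N ω) l) 2 P := fun N =>
    memLp_finsetSum (Finset.univ) fun (j : ι) _ => ((h j).1 N).const_mul (A l j)
  have hi : ∀ N j, Integrable (fun ω => ‖U N ω j - u j‖ ^ 2) P := fun N j =>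
    integrable_norm_sq (((h j).1 N).sub (memLp_const _))
  refine ⟨hm, ?_⟩
  have hlim : Tendsto (fun N => (∑ j, ‖A l j‖ ^ 2) * ∑ j, ∫ ω, ‖U N ω j - u j‖ ^ 2 ∂P)
      atTop (𝓝 0) := by
    have h1 : Tendsto (fun N => ∑ j, ∫ ω, ‖U N ω j - u j‖ ^ 2 ∂P) atTop (𝓝 (∑ _j : ι, 0)) :=
      tendsto_finsetSum _ fun j _ => (h j).2
    simpa using h1.const_mul (∑ j, ‖A l j‖ ^ 2)
  refine squeeze_zero (fun N => integral_nonneg fun ω => by positivity) (fun N => ?_) hlim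
  rw [← integral_finsetSum _ fun j _ => hi N j, ← integral_const_mul]
  refine integral_mono (integrable_norm_sq ((hm N).sub (memLp_const _)))
    ((integrable_finsetSum _ fun j _ => hi N j).const_mul _) fun ω => ?_
  have e : (A *ᵥ U N ω) l - (A *ᵥ u) l = ∑ j, A l j * (U N ω j - u j) := by
    simp only [Matrix.mulVec, dotProduct, mul_sub, Finset.sum_sub_distrib]
  simp only
  rw [e]
  have h1 : ‖∑ j, A l j * (U N ω j - u j)‖ ≤ ∑ j, ‖A l j‖ * ‖U N ω j - u j‖ :=
    (norm_sum_le _ _).trans (le_of_eq (by simp only [norm_mul]))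
  exact (pow_le_pow_left₀ (norm_nonneg _) h1 2).trans (Finset.sum_mul_sq_le_sq_mul_sq _ _ _)

lemma MeanSquareConsistent.isConsistent [IsProbabilityMeasure P] {est : ℕ → Ω → κ → 𝕜} {v : κ → 𝕜}
    (h : MeanSquareConsistent P est v) : IsConsistent P est v := by
  intro l
  refine ⟨(h l).2, tendstoInMeasure_of_tendsto_eLpNorm (p := 2) (by norm_num)
    (fun N => ((h l).1 N).aestronglyMeasurable) aestronglyMeasurable_const ?_⟩
  have e : ∀ N, eLpNorm ((fun ω => est N ω l) - fun _ => v l) 2 P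
      = ENNReal.ofReal ((∫ ω, ‖est N ω l - v l‖ ^ 2 ∂P) ^ (2 : ℝ)⁻¹) := by
    intro N
    rw [(((h l).1 N).sub (memLp_const (v l))).eLpNorm_eq_integral_rpow_norm (by norm_num)
      (by norm_num)]
    simp
  simp_rw [e]
  have h1 := ((h l).2.rpow_const (p := (2 : ℝ)⁻¹) (Or.inr (by norm_num)))
  rw [Real.zero_rpow (by norm_num)] at h1
  simpa [Function.comp_def] using (ENNReal.continuous_ofReal.tendsto _).comp h1

/-- The diagonal of the covariance matrix is at most twice the mean-square error plus twice the squared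
bias, and the diagonal dominates the other entries. -/
lemma MeanSquareConsistent.varianceVanishes [IsProbabilityMeasure P] {est : ℕ → Ω → κ → 𝕜}
    {v : κ → 𝕜} (h : MeanSquareConsistent P est v) (hu : AsympUnbiased P est v) :
    VarianceVanishes P est := by
  refine ⟨fun N l => (h l).1 N, fun k l => ?_⟩
  have hm : ∀ N j, MemLp (fun ω => est N ω j - ∫ ω', est N ω' j ∂P) 2 P := fun N j =>
    ((h j).1 N).sub (memLp_const _)
  have hB : ∀ j, Tendsto (fun N => 2 * (∫ ω, ‖est N ω j - v j‖ ^ 2 ∂P) +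
      2 * ‖∫ ω, est N ω j ∂P - v j‖ ^ 2) atTop (𝓝 0) := by
    intro j
    have h1 := tendsto_iff_norm_sub_tendsto_zero.1 (hu j).2
    simpa using ((h j).2.const_mul 2).add ((h1.pow 2).const_mul 2)
  have hle : ∀ j N, ∫ ω, ‖est N ω j - ∫ ω', est N ω' j ∂P‖ ^ 2 ∂P
      ≤ 2 * (∫ ω, ‖est N ω j - v j‖ ^ 2 ∂P) + 2 * ‖∫ ω, est N ω j ∂P - v j‖ ^ 2 := by
    intro j N
    set μ := ∫ ω, est N ω j ∂P
    have hi : Integrable (fun ω => 2 * ‖est N ω j - v j‖ ^ 2) P :=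
      (integrable_norm_sq (((h j).1 N).sub (memLp_const _))).const_mul 2
    have e : 2 * (∫ ω, ‖est N ω j - v j‖ ^ 2 ∂P) + 2 * ‖μ - v j‖ ^ 2
        = ∫ ω, (2 * ‖est N ω j - v j‖ ^ 2 + 2 * ‖μ - v j‖ ^ 2) ∂P := by
      rw [integral_add hi (integrable_const _), integral_const_mul, integral_const]
      simp
    rw [e]
    refine integral_mono (integrable_norm_sq (hm N j)) (hi.add (integrable_const _)) fun ω => ?_
    have h1 := norm_sub_le (est N ω j - v j) (μ - v j)
    rw [sub_sub_sub_cancel_right] at h1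
    have h2 := pow_le_pow_left₀ (norm_nonneg _) h1 2
    simp only
    nlinarith [sq_nonneg (‖est N ω j - v j‖ - ‖μ - v j‖)]
  have hlim := (hB k).add (hB l)
  rw [add_zero] at hlim
  refine squeeze_zero_norm (fun N => ?_) hlim
  rw [covMat, Matrix.of_apply]
  refine (norm_integral_le_integral_norm _).trans ?_
  refine le_trans ?_ (add_le_add (hle k N) (hle l N))
  rw [← integral_add (integrable_norm_sq (hm N k)) (integrable_norm_sq (hm N l))]
  refine integral_mono_of_nonneg (ae_of_all _ fun ω => norm_nonneg _)
    ((integrable_norm_sq (hm N k)).add (integrable_norm_sq (hm N l))) (ae_of_all _ fun ω => ?_)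
  simp only
  rw [norm_mul, RCLike.norm_conj]
  nlinarith [sq_nonneg (‖est N ω k - ∫ ω', est N ω' k ∂P‖ - ‖est N ω l - ∫ ω', est N ω' l ∂P‖),
    sq_nonneg (‖est N ω k - ∫ ω', est N ω' k ∂P‖ + ‖est N ω l - ∫ ω', est N ω' l ∂P‖)]

/-- The mean-square error is the variance plus the squared bias. -/
lemma meanSquareConsistent_of_variance [IsProbabilityMeasure P] {U : ℕ → Ω → ι → ℝ} {u : ι → ℝ}
    (hu : AsympUnbiased P U u) (hL : ∀ i N, MemLp (fun ω => U N ω i) 2 P)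
    (hv : ∀ i, Tendsto (fun N => variance (fun ω => U N ω i) P) atTop (𝓝 0)) :
    MeanSquareConsistent P U u := by
  intro i
  refine ⟨hL i, ?_⟩
  have h1 := tendsto_iff_norm_sub_tendsto_zero.1 (hu i).2
  have hlim := (hv i).add (h1.pow 2)
  norm_num only [zero_add] at hlim
  refine hlim.congr fun N => ?_
  have hm := (hL i N).sub (memLp_const (u i))
  have h2 := variance_eq_sub hm
  have h3 : variance ((fun ω => U N ω i) - fun _ => u i) P = variance (fun ω => U N ω i) P :=
    variance_sub_const (hL i N).aestronglyMeasurable (u i)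
  rw [h3] at h2
  have h4 : ∫ ω, ((fun ω => U N ω i) - fun _ => u i : Ω → ℝ) ω ∂P = ∫ ω, U N ω i ∂P - u i := by
    simp only [Pi.sub_apply]
    rw [integral_sub ((hu i).1 N) (integrable_const _)]
    simp
  rw [h2, h4, Real.norm_eq_abs, sq_abs, sub_add_cancel]
  simp only [Pi.pow_apply, Pi.sub_apply, Real.norm_eq_abs, sq_abs]

open scoped ComplexOrder in
lemma pinv_mulVec_mulVec [Fintype ι] [Fintype κ] [DecidableEq κ] {A : Matrix ι κ 𝕜}
    (hA : A.rank = Fintype.card κ) (v : κ → 𝕜) : pinv A *ᵥ (A *ᵥ v) = v := by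
  have hdet : IsUnit (Aᴴ * A).det := by
    rw [← Matrix.isUnit_iff_isUnit_det, ← Matrix.mulVec_surjective_iff_isUnit]
    have h := Matrix.rank_conjTranspose_mul_self A
    rw [hA, Matrix.rank] at h
    have htop := Submodule.eq_top_of_finrank_eq (h.trans (Module.finrank_fintype_fun_eq_card 𝕜).symm)
    exact LinearMap.range_eq_top.1 htop
  rw [Matrix.mulVec_mulVec, pinv, Matrix.mul_assoc, Matrix.nonsing_inv_mul _ hdet,
    Matrix.one_mulVec]

end Estimators

/-! ### The stacked real system -/

lemma stackReIm_ofReal {q : ℕ} (w : PairIndex q → ℝ) :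
    stackReIm (fun i => (w i : ℂ)) = Sum.elim w fun _ => 0 := by
  funext s
  rcases s with i | p <;> simp [stackReIm]

lemma PsiReal_mulVec {q L : ℕ} (a₀ : Fin q) (c : Fin q → ℕ) (v : Fin L → ℝ) :
    PsiReal a₀ L c *ᵥ v = stackReIm (Psi a₀ L c *ᵥ fun l => (v l : ℂ)) := by
  funext s
  rcases s with i | p
  · simp [PsiReal, stackReIm, Matrix.mulVec, dotProduct]
  · simp [PsiReal, stackReIm, Matrix.mulVec, dotProduct]

section Stack

variable {Ω : Type*} [MeasurableSpace Ω] {P : Measure Ω} {q : ℕ}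
  {U : ℕ → Ω → PairIndex q → ℝ} {u : PairIndex q → ℝ}

lemma AsympUnbiased.ofReal (h : AsympUnbiased P U u) :
    AsympUnbiased P (fun N ω i => (U N ω i : ℂ)) (fun i => (u i : ℂ)) := fun i =>
  ⟨fun N => ((h i).1 N).ofReal, by
    have := (Complex.continuous_ofReal.tendsto _).comp (h i).2
    simpa only [Function.comp_def, ← integral_complex_ofReal] using this⟩

lemma MeanSquareConsistent.ofReal (h : MeanSquareConsistent P U u) :
    MeanSquareConsistent P (fun N ω i => (U N ω i : ℂ)) (fun i => (u i : ℂ)) := fun i =>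
  ⟨fun N => ((h i).1 N).ofReal, by
    have := (h i).2
    simpa only [← Complex.ofReal_sub, Complex.norm_real] using this⟩

lemma AsympUnbiased.stackReIm (h : AsympUnbiased P U u) :
    AsympUnbiased P (fun N ω => stackReIm fun i => (U N ω i : ℂ))
      (stackReIm fun i => (u i : ℂ)) := by
  simp_rw [stackReIm_ofReal]
  rintro (i | p)
  · exact h i
  · exact ⟨fun N => integrable_zero _ _ _, by simp⟩

lemma MeanSquareConsistent.stackReIm (h : MeanSquareConsistent P U u) :
    MeanSquareConsistent P (fun N ω => stackReIm fun i => (U N ω i : ℂ))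
      (stackReIm fun i => (u i : ℂ)) := by
  simp_rw [stackReIm_ofReal]
  rintro (i | p)
  · exact h i
  · exact ⟨fun N => MemLp.zero, by simp⟩

end Stack

end MultiCoset

end

open MultiCoset in
theorem mainTheorem1 {Ω : Type*} [MeasurableSpace Ω] (P : Measure Ω) [IsProbabilityMeasure P]
    (x : ℝ → Ω → ℝ) (r S : ℝ → ℝ) (W : ℝ) (hW : 0 < W)
    (hx : IsZeroMeanWSS P x r) (hS : IsPSD S r) (hband : IsBandLimited S W)
    (q L : ℕ) (hL : 0 < L) (hLeven : Even L)
    (c : Fin q → ℕ) (hc : ∀ i, c i < L) (hcinj : Function.Injective c) (a₀ : Fin q) :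
    -- the ideally delayed sequences exist
    (∃ z : Fin q → ℤ → Ω → ℝ, IsFilterOutput P (delayFilter L c) (mcSample x W L c) z) ∧
    ∀ z : Fin q → ℤ → Ω → ℝ, IsFilterOutput P (delayFilter L c) (mcSample x W L c) z →
      -- they are jointly stationary
      (∀ (a b : Fin q) (k n : ℤ),
        ∫ ω, z a (k + n) ω * z b n ω ∂P = crossCorr P (z a) (z b) k) ∧
      -- the sample correlations are asymptotically unbiased
      AsympUnbiased P (corrEst a₀ (delayFilter L c) (mcSample x W L c)) (corrVec P a₀ z) ∧
      -- their variances vanish in the Gaussian, square-summable case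
      (∀ i : PairIndex q,
        JointlyGaussian P (mcSample x W L c (pairOf a₀ i).1) (mcSample x W L c (pairOf a₀ i).2) →
        Summable (fun m : ℤ => crossCorr P (z (pairOf a₀ i).1) (z (pairOf a₀ i).2) m ^ 2) →
        (∀ N, MemLp (fun ω => corrEst a₀ (delayFilter L c) (mcSample x W L c) N ω i) 2 P) ∧
        Tendsto (fun N => variance
          (fun ω => corrEst a₀ (delayFilter L c) (mcSample x W L c) N ω i) P) atTop (𝓝 0)) ∧
      -- the noncompressive estimator
      ((Psi a₀ L c).rank = L →
        AsympUnbiased P (ncEst a₀ L c (mcSample x W L c))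
          (pinv (Psi a₀ L c) *ᵥ fun i => (corrVec P a₀ z i : ℂ)) ∧
        (pinv (Psi a₀ L c) *ᵥ fun i => (corrVec P a₀ z i : ℂ))
          = (fun l => (powerVec S W L l : ℂ)) ∧
        ((∀ i : PairIndex q, JointlyGaussian P (mcSample x W L c (pairOf a₀ i).1)
            (mcSample x W L c (pairOf a₀ i).2)) →
          (∀ i : PairIndex q, Summable
            (fun m : ℤ => crossCorr P (z (pairOf a₀ i).1) (z (pairOf a₀ i).2) m ^ 2)) →
          VarianceVanishes P (ncEst a₀ L c (mcSample x W L c)) ∧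
          IsConsistent P (ncEst a₀ L c (mcSample x W L c))
            (fun l => (powerVec S W L l : ℂ)))) ∧
      -- the same for the stacked real system
      ((PsiReal a₀ L c).rank = L →
        AsympUnbiased P (ncEstReal a₀ L c (mcSample x W L c))
          (pinv (PsiReal a₀ L c) *ᵥ stackReIm (fun i => (corrVec P a₀ z i : ℂ))) ∧
        (pinv (PsiReal a₀ L c) *ᵥ stackReIm (fun i => (corrVec P a₀ z i : ℂ)))
          = powerVec S W L ∧
        ((∀ i : PairIndex q, JointlyGaussian P (mcSample x W L c (pairOf a₀ i).1)
            (mcSample x W L c (pairOf a₀ i).2)) →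
          (∀ i : PairIndex q, Summable
            (fun m : ℤ => crossCorr P (z (pairOf a₀ i).1) (z (pairOf a₀ i).2) m ^ 2)) →
          VarianceVanishes P (ncEstReal a₀ L c (mcSample x W L c)) ∧
          IsConsistent P (ncEstReal a₀ L c (mcSample x W L c)) (powerVec S W L))) := by
  refine ⟨exists_isFilterOutput hW hL hx hS hc, fun z hz => ?_⟩
  have hunb := asympUnbiased_corrEst hW hL hx hS hc a₀ hz
  have hvar := memLp_and_tendsto_variance_corrEst hW hL hx hS hc a₀ hz
  have hms : (∀ i : PairIndex q, JointlyGaussian P (mcSample x W L c (pairOf a₀ i).1)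
      (mcSample x W L c (pairOf a₀ i).2)) → MeanSquareConsistent P
        (corrEst a₀ (delayFilter L c) (mcSample x W L c)) (corrVec P a₀ z) := fun hG =>
    meanSquareConsistent_of_variance hunb (fun i => (hvar i (hG i)).1)
      fun i => (hvar i (hG i)).2
  have hu := corrVec_eq_mulVec hW hL hLeven hx hS hband hc a₀ hz
  refine ⟨fun a b k n => ?_, hunb, fun i hG _ => hvar i hG, fun hrank => ?_, fun hrank => ?_⟩
  · rw [hz.integral_mul_eq_crossCorr hW hL hx hS hc, add_sub_cancel_right]
  · have hv : (pinv (Psi a₀ L c) *ᵥ fun i => (corrVec P a₀ z i : ℂ))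
        = fun l => (powerVec S W L l : ℂ) := by
      rw [hu]
      exact pinv_mulVec_mulVec (by rw [hrank, Fintype.card_fin]) _
    have h1 : AsympUnbiased P (ncEst a₀ L c (mcSample x W L c)) _ :=
      hunb.ofReal.mulVec (pinv (Psi a₀ L c))
    refine ⟨h1, hv, fun hG _ => ?_⟩
    have h2 : MeanSquareConsistent P (ncEst a₀ L c (mcSample x W L c)) _ :=
      (hms hG).ofReal.mulVec (pinv (Psi a₀ L c))
    rw [hv] at h1 h2
    exact ⟨h2.varianceVanishes h1, h2.isConsistent⟩
  · have hv : (pinv (PsiReal a₀ L c) *ᵥ stackReIm (fun i => (corrVec P a₀ z i : ℂ)))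
        = powerVec S W L := by
      rw [hu, ← PsiReal_mulVec]
      exact pinv_mulVec_mulVec (by rw [hrank, Fintype.card_fin]) _
    have h1 : AsympUnbiased P (ncEstReal a₀ L c (mcSample x W L c)) _ :=
      hunb.stackReIm.mulVec (pinv (PsiReal a₀ L c))
    refine ⟨h1, hv, fun hG _ => ?_⟩
    have h2 : MeanSquareConsistent P (ncEstReal a₀ L c (mcSample x W L c)) _ :=
      (hms hG).stackReIm.mulVec (pinv (PsiReal a₀ L c))
    rw [hv] at h1 h2
    exact ⟨h2.varianceVanishes h1, h2.isConsistent⟩
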